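/- **Setting.** Let $\mathbb F_2$ be the field with two elements and $\delta\in[0,1]$. For $n$ independent qubit erasure channels with parameter $\delta$, each of which acts on a qubit state by $$\rho\mapsto(1-\delta)\,\rho\otimes|0\rangle\langle 0|+\tfrac{\delta}{4}\left(\rho+X\rho X+Z\rho Z+XZ\rho ZX\right)\otimes|1\rangle\langle 1|,$$ let $p_{UV}$ be the joint distribution of the Pauli error $U\in\mathbb F_2^{2n}$ and the vector of erasure flags $V\in\mathbb F_2^{n}$. (For each qubit $i$, coordinate $i$ of $U$ is the exponent of $X$ and coordinate $2n+1-i$ is the exponent of $Z$. Independently for each qubit, with probability $1-\delta$ the flag is $0$ and both exponents are $0$; with probability $\delta$ the flag is $1$ and the two exponents are uniformly distributed.) For each $v$ list the vectors of $\mathbb F_2^{2n}$ in decreasing order of $p_{UV}(\cdot,v)$, with ties resolved arbitrarily, and let $J\in\{1,\dots,2^{2n}\}$ be the position of $U$ in the list for $V$. For $0\le k\le n$, $m=n-k$ and $r=k/n$, put $$\varepsilon_{\mathrm{conv}}(r)=\Pr[J>2^m],\qquad \varepsilon_{\mathrm{ach}}(r)=\Pr[J>2^m]+\mathbb E\left[1_{\{J\le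 2^m\}}(J-1)2^{-m}\right].$$ Let $T$ be the $2n\times 2n$ matrix over $\mathbb F_2$ with ones exactly on the reverse diagonal. For $\epsilon\in(0,1)$ let $R(p_{UV},\epsilon)$ be the maximum of $k/n$ over all $0\le k\le n$ for which there are a matrix $C$ over $\mathbb F_2$ with $C^{\top}TC=T$ and a decoder $D$ such that $\Pr[D(V,S)\ne U]\le\epsilon$, where $S\in\mathbb F_2^{m}$, $m=n-k$, consists of the first $m$ coordinates of $CU$. Let $F(n,p,i)=\sum_{i'=0}^{i}\binom{n}{i'}p^{i'}(1-p)^{n-i'}$ and $\Phi(x)=\frac{1}{\sqrt{2\pi}}\int_{-\infty}^{x}e^{-t^2/2}\,dt$. **Theorem.** For all $n$, all $0\le k\le n$, $m=n-k$, $r=k/n$, $$\varepsilon_{\mathrm{conv}}(r)=F\left(n,1-\delta,n-\lfloor\tfrac m2\rfloor-1\right)-2^m\left(\tfrac{4-3\delta}{4}\right)^{n}F\left(n,\tfrac{4-4\delta}{4-3\delta},n-\lfloor\tfrac m2\rfloor-1\right)$$ and $$\begin{aligned}\varepsilon_{\mathrm{ach}}(r)={}&\left(1+\tfrac{1}{2^{m+1}}\right)F\left(n,1-\delta,n-\lfloor\tfrac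 m2\rfloor-1\right)-\tfrac{1}{2^{m+1}}\\&-\tfrac{2^m+1}{2}\left(\tfrac{4-3\delta}{4}\right)^{n}F\left(n,\tfrac{4-4\delta}{4-3\delta},n-\lfloor\tfrac m2\rfloor-1\right)+\tfrac{(1+3\delta)^n}{2^{m+1}}F\left(n,\tfrac{4\delta}{1+3\delta},\lfloor\tfrac m2\rfloor\right).\end{aligned}$$ Moreover, let $\epsilon\in(0,1)$ be fixed, and suppose that $\delta<\tfrac12$, or that $\delta=\tfrac12$ and $\epsilon\ge\tfrac12$. Then for all sufficiently large $n$ the maximum $R(p_{UV},\epsilon)$ exists, and as $n\to\infty$ $$R(p_{UV},\epsilon)=1-2\delta+\frac{2\,\Phi^{-1}(\epsilon)\sqrt{\delta(1-\delta)}}{\sqrt n}+O\left(\frac1n\right),$$ where the implied constant may depend on $\delta$ and $\epsilon$. -/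

import Mathlib

open Filter Asymptotics
open scoped Kronecker

/-- Vectors in `𝔽₂^{2n}`; they label the `n`-qubit Pauli errors. -/
abbrev PauliVec (n : ℕ) : Type := Fin (2 * n) → ZMod 2

/-- The coordinate of `u` giving the power of `X` on qubit `i` (the `i`-th coordinate). -/
def PauliVec.xPart {n : ℕ} (u : PauliVec n) (i : Fin n) : ZMod 2 :=
  u (Fin.castLE (by omega) i)

/-- The coordinate of `u` giving the power of `Z` on qubit `i`. The generators are ordered
`X₁, …, Xₙ, Zₙ, …, Z₁`, so this is the `i`-th coordinate from the end. -/
def PauliVec.zPart {n : ℕ} (u : PauliVec n) (i : Fin n) : ZMod 2 :=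
  u (Fin.rev (Fin.castLE (by omega) i))

/-- The joint distribution `p_{UV}` of a Pauli error `U` in `𝔽₂^{2n}` and of classical side
information `V` with finitely many values. -/
structure PauliNoise (n : ℕ) (V : Type*) [Fintype V] where
  /-- `mass u v` is the probability that `U = u` and `V = v`. -/
  mass : PauliVec n → V → ℝ
  mass_nonneg : ∀ u v, 0 ≤ mass u v
  sum_mass : ∑ u, ∑ v, mass u v = 1

namespace PauliNoise

variable {n : ℕ} {V : Type*} [Fintype V]

open Classical in
/-- The probability of the event `E(U, V)`. -/
noncomputable def probOf (p : PauliNoise n V) (E : PauliVec n → V → Prop) : ℝ :=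
  ∑ u, ∑ v, if E u v then p.mass u v else 0

/-- The expectation of `f(U, V)`. -/
noncomputable def expect (p : PauliNoise n V) (f : PauliVec n → V → ℝ) : ℝ :=
  ∑ u, ∑ v, p.mass u v * f u v

end PauliNoise

/-! ### Symplectic matrices, syndromes, guessing the error -/

/-- The matrix with ones on the reverse diagonal. -/
def revDiag (N : ℕ) : Matrix (Fin N) (Fin N) (ZMod 2) :=
  Matrix.of fun i j => if j = Fin.rev i then 1 else 0

/-- The symplectic matrices: those that preserve the form `xᵀ R y`, `R` the reverse diagonal. -/
def symplecticMatrices (n : ℕ) : Set (Matrix (Fin (2 * n)) (Fin (2 * n)) (ZMod 2)) :=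
  {C | C.transpose * revDiag (2 * n) * C = revDiag (2 * n)}

/-- The syndrome of `u`: the first `m = n - k` coordinates of `C u`. -/
def syndrome {n : ℕ} (k : ℕ) (C : Matrix (Fin (2 * n)) (Fin (2 * n)) (ZMod 2))
    (u : PauliVec n) : Fin (n - k) → ZMod 2 :=
  fun i => C.mulVec u (Fin.castLE (by omega) i)

namespace PauliNoise

variable {n : ℕ} {V : Type*} [Fintype V]

/-- The probability that the decoder `D`, given the side information and the `m = n - k` bits
of syndrome, guesses the error `U` incorrectly. -/
noncomputable def wrongGuessProb (p : PauliNoise n V) (k : ℕ)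
    (C : Matrix (Fin (2 * n)) (Fin (2 * n)) (ZMod 2))
    (D : V → (Fin (n - k) → ZMod 2) → PauliVec n) : ℝ :=
  p.probOf fun u v => D v (syndrome k C u) ≠ u

/-- The rates `k / n` (with `n = m + k`) at which some symplectic `C` and some decoder `D` guess
the error incorrectly with probability at most `ε`. -/
def guessableRates (p : PauliNoise n V) (ε : ℝ) : Set ℝ :=
  {r | ∃ k : ℕ, k ≤ n ∧ r = (k : ℝ) / n ∧
    ∃ C ∈ symplecticMatrices n, ∃ D : V → (Fin (n - k) → ZMod 2) → PauliVec n,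
      p.wrongGuessProb k C D ≤ ε}

/-- The optimal rate for guessing the error from the syndrome. The set of rates is finite, so
this is its maximum as soon as it is nonempty. -/
noncomputable def errorGuessRate (p : PauliNoise n V) (ε : ℝ) : ℝ :=
  sSup (p.guessableRates ε)

/-! ### Sorting the errors by likelihood, and the general bounds -/

/-- `ord v 0, ord v 1, …` lists, for every `v`, all the vectors `u` in order of decreasing
probability of `U = u, V = v`, ties being resolved in any way. -/
def IsSorting (p : PauliNoise n V) (ord : V → Fin (2 ^ (2 * n)) ≃ PauliVec n) : Prop :=
  ∀ v, Antitone fun j => p.mass (ord v j) v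

theorem exists_isSorting (p : PauliNoise n V) : ∃ ord, p.IsSorting ord := by
  have hc : Fintype.card (PauliVec n) = 2 ^ (2 * n) := by simp [PauliVec, ZMod.card]
  let e : PauliVec n ≃ Fin (2 ^ (2 * n)) := Fintype.equivFinOfCardEq hc
  refine ⟨fun v => (Tuple.sort fun j => - p.mass (e.symm j) v).trans e.symm, fun v i j hij => ?_⟩
  have h := Tuple.monotone_sort (fun j => - p.mass (e.symm j) v) hij
  simpa using h

/-- The position `J ∈ {1, …, 2^{2n}}` of `u` in the list for `v`. -/
def position (ord : V → Fin (2 ^ (2 * n)) ≃ PauliVec n) (u : PauliVec n) (v : V) : ℕ :=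
  ((ord v).symm u : ℕ) + 1

/-- The converse bound `P[J > 2^m]` at rate `k / n`, where `m = n - k`. -/
noncomputable def converseBound (p : PauliNoise n V)
    (ord : V → Fin (2 ^ (2 * n)) ≃ PauliVec n) (k : ℕ) : ℝ :=
  p.probOf fun u v => 2 ^ (n - k) < position ord u v

/-- The achievability bound `P[J > 2^m] + E[1{J ≤ 2^m} (J - 1) 2^{-m}]` at rate `k / n`, where
`m = n - k`. -/
noncomputable def achievabilityBound (p : PauliNoise n V)
    (ord : V → Fin (2 ^ (2 * n)) ≃ PauliVec n) (k : ℕ) : ℝ :=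
  p.probOf (fun u v => 2 ^ (n - k) < position ord u v) +
    p.expect fun u v =>
      if position ord u v ≤ 2 ^ (n - k) then ((position ord u v : ℝ) - 1) / 2 ^ (n - k) else 0

end PauliNoise

/-! ### The erasure channels -/

/-- The probability, for a single qubit erasure channel with parameter `δ`, that the flag is `v`
(`1` for erased) and that the Pauli error `X^x Z^z` is applied. -/
noncomputable def erasureWeight (δ : ℝ) (x z v : ZMod 2) : ℝ :=
  if v = 0 then (if x = 0 ∧ z = 0 then 1 - δ else 0) else δ / 4

/-- A sum over all Pauli errors of a product over the qubits factorizes. -/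
theorem sum_prod_pauliVec {R : Type*} [CommSemiring R] (n : ℕ)
    (f : Fin n → ZMod 2 → ZMod 2 → R) :
    ∑ u : PauliVec n, ∏ i, f i (u.xPart i) (u.zPart i) = ∏ i, ∑ x, ∑ z, f i x z := by
  let g : PauliVec n → (Fin n → ZMod 2 × ZMod 2) := fun u i => (u.xPart i, u.zPart i)
  have hg : Function.Injective g := by
    intro u w h
    funext j
    by_cases hj : (j : ℕ) < n
    · have := congrArg Prod.fst (congrFun h ⟨j, hj⟩)
      exact this
    · have hj2 := j.isLt
      have h2 := congrArg Prod.snd (congrFun h ⟨2 * n - 1 - j, by omega⟩)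
      have he : Fin.rev (Fin.castLE (by omega) (⟨2 * n - 1 - j, by omega⟩ : Fin n)) = j := by
        apply Fin.ext
        simp only [Fin.val_rev, Fin.castLE_mk]
        omega
      simp only [g, PauliVec.zPart] at h2
      rwa [he] at h2
  have hb : Function.Bijective g := by
    rw [Fintype.bijective_iff_injective_and_card]
    refine ⟨hg, ?_⟩
    simp [PauliVec, ZMod.card, pow_mul]
  calc ∑ u : PauliVec n, ∏ i, f i (u.xPart i) (u.zPart i)
      = ∑ w : Fin n → ZMod 2 × ZMod 2, ∏ i, f i (w i).1 (w i).2 :=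
        Fintype.sum_bijective g hb _ _ fun _ => rfl
    _ = ∏ i, ∑ y : ZMod 2 × ZMod 2, f i y.1 y.2 :=
        (Fintype.prod_sum fun i (y : ZMod 2 × ZMod 2) => f i y.1 y.2).symm
    _ = ∏ i, ∑ x, ∑ z, f i x z := by simp only [Fintype.sum_prod_type]

/-- The distribution `p_{UV}` for `n` independent qubit erasure channels with parameter `δ`; the
side information is the vector of the `n` erasure flags. -/
noncomputable def erasureNoise (n : ℕ) (δ : ℝ) (hδ : δ ∈ Set.Icc (0 : ℝ) 1) :
    PauliNoise n (Fin n → ZMod 2) where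
  mass u v := ∏ i, erasureWeight δ (u.xPart i) (u.zPart i) (v i)
  mass_nonneg u v := by
    obtain ⟨h0, h1⟩ := hδ
    refine Finset.prod_nonneg fun i _ => ?_
    unfold erasureWeight
    split_ifs <;> linarith
  sum_mass := by
    rw [Finset.sum_comm]
    simp_rw [fun v : Fin n → ZMod 2 =>
      sum_prod_pauliVec n fun i x z => erasureWeight δ x z (v i)]
    rw [← Fintype.prod_sum fun (_ : Fin n) (b : ZMod 2) => ∑ x, ∑ z, erasureWeight δ x z b]
    refine Finset.prod_eq_one fun i _ => ?_
    have h2 : ∀ f : ZMod 2 → ℝ, ∑ x, f x = f 0 + f 1 := fun f => Fin.sum_univ_two f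
    simp only [h2, erasureWeight]
    norm_num
    ring

/-! The quantum channels. The theorem `pauliChannel_erasureNoise` confirms that `erasureNoise` is
the distribution that specifies, as a Pauli channel, the tensor product of `n` erasure channels. -/

/-- The tensor product of matrices on the single qubits. -/
def qubitTensor {n : ℕ} (A : Fin n → Matrix (Fin 2) (Fin 2) ℂ) :
    Matrix (Fin n → Fin 2) (Fin n → Fin 2) ℂ :=
  Matrix.of fun a b => ∏ i, A i (a i) (b i)

/-- The single qubit operator `X^x Z^z`. -/
def qubitPauli (x z : ZMod 2) : Matrix (Fin 2) (Fin 2) ℂ :=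
  !![0, 1; 1, 0] ^ x.val * !![1, 0; 0, -1] ^ z.val

/-- The `n`-qubit Pauli operator `X₁^{u₁} ⋯ Xₙ^{uₙ} Zₙ^{uₙ₊₁} ⋯ Z₁^{u₂ₙ}`. -/
def pauliOperator {n : ℕ} (u : PauliVec n) : Matrix (Fin n → Fin 2) (Fin n → Fin 2) ℂ :=
  qubitTensor fun i => qubitPauli (u.xPart i) (u.zPart i)

/-- The Pauli channel `ρ ↦ ∑ p(u, v) Q^u ρ (Q^u)† ⊗ |v⟩⟨v|`. -/
noncomputable def pauliChannel {n : ℕ} {V : Type*} [Fintype V] [DecidableEq V]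
    (p : PauliNoise n V) (ρ : Matrix (Fin n → Fin 2) (Fin n → Fin 2) ℂ) :
    Matrix ((Fin n → Fin 2) × V) ((Fin n → Fin 2) × V) ℂ :=
  ∑ u, ∑ v, (p.mass u v : ℂ) •
    ((pauliOperator u * ρ * (pauliOperator u).conjTranspose) ⊗ₖ Matrix.single v v 1)

/-- The qubit erasure channel
`ρ ↦ (1 - δ) ρ ⊗ |0⟩⟨0| + (δ / 4) (ρ + X ρ X + Z ρ Z + X Z ρ Z X) ⊗ |1⟩⟨1|`. -/
noncomputable def erasureChannel (δ : ℝ) (ρ : Matrix (Fin 2) (Fin 2) ℂ) :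
    Matrix (Fin 2 × ZMod 2) (Fin 2 × ZMod 2) ℂ :=
  let X : Matrix (Fin 2) (Fin 2) ℂ := !![0, 1; 1, 0]
  let Z : Matrix (Fin 2) (Fin 2) ℂ := !![1, 0; 0, -1]
  ((1 - δ : ℝ) : ℂ) • (ρ ⊗ₖ Matrix.single 0 0 1) +
    ((δ / 4 : ℝ) : ℂ) •
      ((ρ + X * ρ * X + Z * ρ * Z + X * Z * ρ * Z * X) ⊗ₖ Matrix.single 1 1 1)

theorem qubitTensor_mul {n : ℕ} (A B : Fin n → Matrix (Fin 2) (Fin 2) ℂ) :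
    qubitTensor A * qubitTensor B = qubitTensor fun i => A i * B i := by
  ext a b
  simp only [qubitTensor, Matrix.mul_apply, Matrix.of_apply, ← Finset.prod_mul_distrib]
  exact (Fintype.prod_sum fun i (c : Fin 2) => A i (a i) c * B i c (b i)).symm

theorem qubitTensor_conjTranspose {n : ℕ} (A : Fin n → Matrix (Fin 2) (Fin 2) ℂ) :
    (qubitTensor A).conjTranspose = qubitTensor fun i => (A i).conjTranspose := by
  ext a b
  simp [qubitTensor, Matrix.conjTranspose_apply]

theorem erasureChannel_apply (δ : ℝ) (ρ : Matrix (Fin 2) (Fin 2) ℂ) (a b : Fin 2)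
    (v w : ZMod 2) :
    erasureChannel δ ρ (a, v) (b, w) = ∑ x, ∑ z, ((erasureWeight δ x z v : ℝ) : ℂ) *
      ((qubitPauli x z * ρ * (qubitPauli x z).conjTranspose) a b * if v = w then 1 else 0) := by
  have h2 : ∀ f : ZMod 2 → ℂ, ∑ x, f x = f 0 + f 1 := fun f => Fin.sum_univ_two f
  have h01 : ∀ y : ZMod 2, y = 0 ∨ y = 1 := by decide
  have hv0 : (0 : ZMod 2).val = 0 := rfl
  have hv1 : (1 : ZMod 2).val = 1 := rfl
  rw [Matrix.eta_fin_two ρ]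
  rcases h01 v with rfl | rfl <;> rcases h01 w with rfl | rfl <;> fin_cases a <;> fin_cases b <;>
    simp [h2, erasureChannel, erasureWeight, qubitPauli, hv0, hv1,
      Matrix.mul_apply, Fin.sum_univ_two] <;> ring

/-- On product inputs the Pauli channel of `erasureNoise` is the product of erasure channels. -/
theorem pauliChannel_erasureNoise {n : ℕ} (δ : ℝ) (hδ : δ ∈ Set.Icc (0 : ℝ) 1)
    (ρ : Fin n → Matrix (Fin 2) (Fin 2) ℂ) (a b : Fin n → Fin 2) (v w : Fin n → ZMod 2) :
    pauliChannel (erasureNoise n δ hδ) (qubitTensor ρ) (a, v) (b, w) =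
      ∏ i, erasureChannel δ (ρ i) (a i, v i) (b i, w i) := by
  simp_rw [erasureChannel_apply]
  rw [← sum_prod_pauliVec n fun i x z => ((erasureWeight δ x z (v i) : ℝ) : ℂ) *
    ((qubitPauli x z * ρ i * (qubitPauli x z).conjTranspose) (a i) (b i) *
      if v i = w i then 1 else 0)]
  simp only [pauliChannel, Matrix.sum_apply, Matrix.smul_apply, Matrix.kroneckerMap_apply,
    pauliOperator, qubitTensor_conjTranspose, qubitTensor_mul, Matrix.single_apply, smul_eq_mul]
  refine Finset.sum_congr rfl fun u _ => ?_
  rw [Finset.sum_eq_single v]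
  · simp only [erasureNoise, qubitTensor, Matrix.of_apply, Finset.prod_mul_distrib,
      Complex.ofReal_prod, true_and]
    congr 2
    by_cases h : v = w
    · subst h; simp
    · obtain ⟨i, hi⟩ := Function.ne_iff.mp h
      rw [if_neg h, eq_comm]
      exact Finset.prod_eq_zero (Finset.mem_univ i) (if_neg hi)
  · intro c _ hc
    simp [hc]
  · simp

/-! ### Distribution functions -/

/-- The probability that a `Binomial(N, q)` random variable is at most `i`; for `i = -1` the sum
is empty. -/
noncomputable def binomialCDF (N : ℕ) (q : ℝ) (i : ℤ) : ℝ :=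
  ∑ j ∈ Finset.range (i + 1).toNat, (N.choose j : ℝ) * q ^ j * (1 - q) ^ (N - j)

/-- The cumulative distribution function of the standard normal distribution. -/
noncomputable def normalCDF (x : ℝ) : ℝ :=
  1 / √(2 * Real.pi) * ∫ t in Set.Iic x, Real.exp (-t ^ 2 / 2)

/-- The inverse of `normalCDF`, meaningful on `(0, 1)`. -/
noncomputable def normalCDFInv : ℝ → ℝ :=
  Function.invFun normalCDF

/-! Once the flags are known, all that matters is the number `e` of erased qubits, which is binomial
with parameters `n` and `δ`. The error is then uniform on the `4 ^ e` vectors supported on the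
erased qubits, so these fill the first `4 ^ e` places of any sorted list, up to ties that carry no
weight, and `J` is uniform on `{1, …, 4 ^ e}` (`erasureNoise_expect_position`). Both bounds thus
become binomial means of explicit functions of `e`, and the factors `4 ^ (-e)` and `4 ^ e` tilt the
binomial weights into those of other binomial distributions. This gives the two exact formulas.

The rate is squeezed between the same two bounds. Converse: for fixed flags a decoder is right on at
most one error per syndrome, hence on at most `2 ^ m` errors. Achievability: choose `C` uniformly
among the symplectic matrices. Transvections make this group transitive on nonzero vectors, so a
nonzero difference of two errors has zero syndrome with probability at most `2 ^ (-m)`; a union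
bound over the more likely errors finishes, and some `C` does at least as well as the average.

Given `e`, both bounds differ from the indicator of `e > m / 2` by a quantity that decays
geometrically in the distance from `e` to `m / 2`. Binomial point masses are of order at most `1 /
s`, with `s = √(n δ (1 - δ))`, so this costs only `O(1 / s)`. A Berry–Esseen bound, proved by
Stein's method, turns both bounds into `1 - Φ((⌊m / 2⌋ - n δ) / s) + O(1 / s)`. As `Φ` has slope
bounded below near `-Φ⁻¹(ε)`, comparison with `ε` determines `⌊m / 2⌋`, hence `k`, up to `O(1)`. At
`δ = 1 / 2` the resulting `k` can be negative; there a symmetry argument shows that rate `0` is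
reachable when `ε ≥ 1 / 2`. -/

/-! ### Expectations with respect to a binomial distribution -/

/-- The expectation of `g (X)` for a `Binomial(n, p)` random variable `X`. -/
noncomputable def binomialMean (n : ℕ) (p : ℝ) (g : ℕ → ℝ) : ℝ :=
  ∑ j ∈ Finset.range (n + 1), (n.choose j : ℝ) * p ^ j * (1 - p) ^ (n - j) * g j

theorem binomialMean_add (n : ℕ) (p : ℝ) (g h : ℕ → ℝ) :
    binomialMean n p (fun j => g j + h j) = binomialMean n p g + binomialMean n p h := by
  simp only [binomialMean, mul_add, Finset.sum_add_distrib]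

theorem binomialMean_sub (n : ℕ) (p : ℝ) (g h : ℕ → ℝ) :
    binomialMean n p (fun j => g j - h j) = binomialMean n p g - binomialMean n p h := by
  simp only [binomialMean, mul_sub, Finset.sum_sub_distrib]

theorem binomialMean_const_mul (n : ℕ) (p c : ℝ) (g : ℕ → ℝ) :
    binomialMean n p (fun j => c * g j) = c * binomialMean n p g := by
  simp only [binomialMean, Finset.mul_sum]
  exact Finset.sum_congr rfl fun j _ => by ring

theorem binomialMean_one (n : ℕ) (p : ℝ) : binomialMean n p (fun _ => 1) = 1 := by
  have h := add_pow p (1 - p) n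
  simp only [add_sub_cancel, one_pow] at h
  refine Eq.trans ?_ h.symm
  exact Finset.sum_congr rfl fun j _ => by ring

theorem binomialMean_const (n : ℕ) (p c : ℝ) : binomialMean n p (fun _ => c) = c := by
  simpa [binomialMean_one] using binomialMean_const_mul n p c fun _ => 1

theorem binomialMean_congr {n : ℕ} {p : ℝ} {g h : ℕ → ℝ} (H : ∀ j ≤ n, g j = h j) :
    binomialMean n p g = binomialMean n p h :=
  Finset.sum_congr rfl fun j hj => by
    rw [H j (Nat.lt_succ_iff.mp (Finset.mem_range.mp hj))]

theorem binomialMean_mono {n : ℕ} {p : ℝ} (hp : p ∈ Set.Icc (0 : ℝ) 1) {g h : ℕ → ℝ}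
    (H : ∀ j ≤ n, g j ≤ h j) : binomialMean n p g ≤ binomialMean n p h := by
  obtain ⟨h0, h1⟩ := hp
  have h2 : 0 ≤ 1 - p := by linarith
  refine Finset.sum_le_sum fun j hj => ?_
  have := H j (Nat.lt_succ_iff.mp (Finset.mem_range.mp hj))
  gcongr

theorem abs_binomialMean_le {n : ℕ} {p : ℝ} (hp : p ∈ Set.Icc (0 : ℝ) 1) (g : ℕ → ℝ) :
    |binomialMean n p g| ≤ binomialMean n p fun j => |g j| := by
  refine abs_le.2 ⟨?_, binomialMean_mono hp fun j _ => le_abs_self _⟩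
  have h := binomialMean_mono (n := n) hp (g := fun j => (-1) * |g j|) (h := g)
    fun j _ => by linarith [neg_abs_le (g j)]
  rw [binomialMean_const_mul] at h
  linarith

/-- Condition on the last of the `n + 1` trials; in coefficients this is Pascal's rule. -/
theorem binomialMean_succ (n : ℕ) (p : ℝ) (g : ℕ → ℝ) :
    binomialMean (n + 1) p g = binomialMean n p fun j => (1 - p) * g j + p * g (j + 1) := by
  have h1 : binomialMean n p (fun j => (1 - p) * g j) =
      ∑ j ∈ Finset.range (n + 2), (n.choose j : ℝ) * p ^ j * (1 - p) ^ (n + 1 - j) * g j := by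
    rw [Finset.sum_range_succ _ (n + 1), binomialMean]
    simp only [Nat.choose_succ_self, Nat.cast_zero, zero_mul, add_zero]
    refine Finset.sum_congr rfl fun j hj => ?_
    rw [Nat.succ_sub (Nat.lt_succ_iff.mp (Finset.mem_range.mp hj)), pow_succ]
    ring
  rw [binomialMean_add, h1, binomialMean, Finset.sum_range_succ', Finset.sum_range_succ' _ (n + 1),
    binomialMean]
  simp only [Nat.choose_succ_succ, Nat.cast_add, add_mul, Finset.sum_add_distrib,
    Nat.add_sub_add_right, Nat.choose_zero_right]
  have h2 : ∑ j ∈ Finset.range (n + 1),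
        (n.choose j : ℝ) * p ^ (j + 1) * (1 - p) ^ (n - j) * g (j + 1) =
      ∑ j ∈ Finset.range (n + 1), (n.choose j : ℝ) * p ^ j * (1 - p) ^ (n - j) *
        (p * g (j + 1)) :=
    Finset.sum_congr rfl fun j _ => by ring
  rw [h2]
  ring

theorem binomialMean_index_mul (n : ℕ) (p : ℝ) (g : ℕ → ℝ) :
    binomialMean (n + 1) p (fun j => j * g j) =
      (n + 1) * p * binomialMean n p fun j => g (j + 1) := by
  rw [binomialMean, Finset.sum_range_succ', binomialMean, Finset.mul_sum]
  simp only [Nat.cast_zero, zero_mul, mul_zero, add_zero, Nat.add_sub_add_right]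
  refine Finset.sum_congr rfl fun j _ => ?_
  have h : ((n : ℝ) + 1) * n.choose j = (n + 1).choose (j + 1) * ((j + 1 : ℕ) : ℝ) := by
    exact_mod_cast Nat.add_one_mul_choose_eq n j
  calc _ = ((n + 1).choose (j + 1) * ((j + 1 : ℕ) : ℝ)) * p ^ (j + 1) * (1 - p) ^ (n - j) *
        g (j + 1) := by ring
    _ = _ := by rw [← h]; ring

/-- Stein's identity for the binomial distribution. -/
theorem binomialMean_stein (n : ℕ) (p : ℝ) (g : ℕ → ℝ) :
    binomialMean (n + 1) p (fun j => (j - (n + 1) * p) * g j) =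
      (n + 1) * p * (1 - p) * binomialMean n p fun j => g (j + 1) - g j := by
  simp only [sub_mul]
  rw [binomialMean_sub, binomialMean_index_mul, binomialMean_const_mul, binomialMean_succ,
    binomialMean_add, binomialMean_const_mul, binomialMean_const_mul, binomialMean_sub]
  ring

theorem binomialMean_variance (n : ℕ) (p : ℝ) :
    binomialMean n p (fun j => (j - n * p) ^ 2) = n * p * (1 - p) := by
  cases n with
  | zero => simp [binomialMean]
  | succ n =>
    have h := binomialMean_stein n p fun j => (j : ℝ) - (n + 1) * p
    have e : (fun j : ℕ => ((j + 1 : ℕ) : ℝ) - (n + 1) * p - (j - (n + 1) * p)) = fun _ => 1 := by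
      funext j; push_cast; ring
    rw [e, binomialMean_one, mul_one] at h
    push_cast
    rw [← h]
    simp only [sq]

theorem binomialMean_abs_deviation_le {n : ℕ} {p : ℝ} (hp : p ∈ Set.Icc (0 : ℝ) 1) :
    binomialMean n p (fun j => |(j : ℝ) - n * p|) ≤ √(n * p * (1 - p)) := by
  have h0 : (0 : ℝ) ≤ n * p * (1 - p) :=
    mul_nonneg (mul_nonneg n.cast_nonneg hp.1) (by linarith [hp.2])
  set s := √(n * p * (1 - p)) with hs
  have hss : s ^ 2 = n * p * (1 - p) := Real.sq_sqrt h0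
  refine le_of_forall_pos_le_add fun e he => ?_
  have hse : 0 < s + e := by positivity
  -- AM–GM with weight `s + e` in place of `s`, so that the degenerate case `s = 0` is covered as `e
  -- → 0`.
  have h : ∀ j ≤ n, |(j : ℝ) - n * p| ≤
      1 / (2 * (s + e)) * ((j : ℝ) - n * p) ^ 2 + (s + e) / 2 := by
    intro j _
    have := two_mul_le_add_sq |(j : ℝ) - n * p| (s + e)
    rw [sq_abs] at this
    rw [← sub_nonneg]
    have e1 : 1 / (2 * (s + e)) * ((j : ℝ) - n * p) ^ 2 + (s + e) / 2 - |(j : ℝ) - n * p| =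
      (((j : ℝ) - n * p) ^ 2 + (s + e) ^ 2 - 2 * |(j : ℝ) - n * p| * (s + e)) / (2 * (s + e)) := by
      field_simp
    rw [e1]
    exact div_nonneg (by linarith) (by positivity)
  refine (binomialMean_mono hp h).trans ?_
  rw [binomialMean_add, binomialMean_const_mul, binomialMean_variance, binomialMean_const, ← hss,
    ← sub_nonneg]
  have e2 : s + e - (1 / (2 * (s + e)) * s ^ 2 + (s + e) / 2) =
      ((s + e) ^ 2 - s ^ 2) / (2 * (s + e)) := by
    field_simp; ring
  rw [e2]
  have : 0 ≤ s := Real.sqrt_nonneg _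
  exact div_nonneg (by nlinarith) (by positivity)

/-- The point probabilities of a binomial distribution are at most `1 / √((n + 1) p (1 - p))`. -/
theorem binomialMean_point_le {n : ℕ} {p : ℝ} (hp : p ∈ Set.Ioo (0 : ℝ) 1) (i : ℕ) :
    binomialMean n p (fun j => if j = i then 1 else 0) ≤ 1 / √((n + 1) * p * (1 - p)) := by
  have hp' : p ∈ Set.Icc (0 : ℝ) 1 := ⟨hp.1.le, hp.2.le⟩
  have hq : 0 < 1 - p := by linarith [hp.2]
  have hp0 := hp.1
  have hpos : 0 < ((n : ℝ) + 1) * p * (1 - p) := by positivity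
  -- The discrete derivative of the indicator of `i < j` is the point mass at `i`, so Stein's
  -- identity bounds variance times point mass by the mean absolute deviation.
  have h := binomialMean_stein n p fun j => if i < j then 1 else 0
  have e : (fun j : ℕ => (if i < j + 1 then (1 : ℝ) else 0) - if i < j then 1 else 0) =
      fun j => if j = i then 1 else 0 := by
    funext j
    split_ifs <;> first | omega | norm_num
  rw [e] at h
  have h2 : binomialMean (n + 1) p (fun j => ((j : ℝ) - (n + 1) * p) * if i < j then 1 else 0) ≤
      √((n + 1) * p * (1 - p)) := by
    have h3 := binomialMean_abs_deviation_le (n := n + 1) hp'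
    push_cast at h3
    refine (binomialMean_mono hp' fun j _ => ?_).trans h3
    split_ifs
    · rw [mul_one]; exact le_abs_self _
    · rw [mul_zero]; exact abs_nonneg _
  rw [h] at h2
  rw [le_div_iff₀ (Real.sqrt_pos.2 hpos)]
  refine le_of_mul_le_mul_right ?_ (Real.sqrt_pos.2 hpos)
  rw [mul_assoc, Real.mul_self_sqrt hpos.le, one_mul, mul_comm]
  exact h2

/-! ### The standard normal distribution function -/

theorem integrable_exp_neg_sq_half :
    MeasureTheory.Integrable fun t : ℝ => Real.exp (-t ^ 2 / 2) := by
  refine (integrable_exp_neg_mul_sq (b := 1 / 2) (by norm_num)).congr (.of_forall fun t => ?_)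
  simp only
  congr 1
  ring

theorem integrable_mul_exp_neg_sq_half :
    MeasureTheory.Integrable fun t : ℝ => t * Real.exp (-t ^ 2 / 2) := by
  refine (integrable_mul_exp_neg_mul_sq (b := 1 / 2) (by norm_num)).congr (.of_forall fun t => ?_)
  simp only
  congr 2
  ring

theorem integral_exp_neg_sq_half : ∫ t : ℝ, Real.exp (-t ^ 2 / 2) = √(2 * Real.pi) := by
  have h := integral_gaussian (1 / 2)
  rw [show Real.pi / (1 / 2) = 2 * Real.pi by ring] at h
  rw [← h]
  congr 1
  funext t
  congr 1
  ring

theorem sqrt_two_pi_pos : 0 < √(2 * Real.pi) := Real.sqrt_pos.2 (by positivity)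

theorem one_le_sqrt_two_pi : 1 ≤ √(2 * Real.pi) :=
  Real.one_le_sqrt.2 (by linarith [Real.pi_gt_three])

theorem one_sub_normalCDF (x : ℝ) :
    1 - normalCDF x = 1 / √(2 * Real.pi) * ∫ t in Set.Ioi x, Real.exp (-t ^ 2 / 2) := by
  have h := MeasureTheory.integral_add_compl (measurableSet_Iic (a := x))
    integrable_exp_neg_sq_half
  rw [integral_exp_neg_sq_half, Set.compl_Iic] at h
  have e := one_div_mul_cancel sqrt_two_pi_pos.ne'
  rw [normalCDF]
  linear_combination -(1 / √(2 * Real.pi)) * h - e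

theorem normalCDF_neg (x : ℝ) : normalCDF (-x) = 1 - normalCDF x := by
  have h := integral_comp_neg_Iic (-x) fun t => Real.exp (-t ^ 2 / 2)
  rw [neg_neg] at h
  rw [one_sub_normalCDF, ← h, normalCDF]
  simp only [neg_sq]

theorem normalCDF_nonneg (x : ℝ) : 0 ≤ normalCDF x :=
  mul_nonneg (by positivity) (MeasureTheory.integral_nonneg fun _ => (Real.exp_pos _).le)

theorem normalCDF_le_one (x : ℝ) : normalCDF x ≤ 1 := by
  have h := normalCDF_nonneg (-x)
  rw [normalCDF_neg] at h
  linarith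

theorem hasDerivAt_normalCDF (x : ℝ) :
    HasDerivAt normalCDF (1 / √(2 * Real.pi) * Real.exp (-x ^ 2 / 2)) x := by
  have hc : Continuous fun t : ℝ => Real.exp (-t ^ 2 / 2) := by fun_prop
  have h := intervalIntegral.integral_hasDerivAt_right (hc.intervalIntegrable 0 x)
    (hc.stronglyMeasurableAtFilter _ _) hc.continuousAt
  have e : normalCDF = fun y => 1 / √(2 * Real.pi) *
      ((∫ t in Set.Iic 0, Real.exp (-t ^ 2 / 2)) + ∫ t in (0 : ℝ)..y, Real.exp (-t ^ 2 / 2)) := by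
    funext y
    rw [← intervalIntegral.integral_Iic_sub_Iic integrable_exp_neg_sq_half.integrableOn
      integrable_exp_neg_sq_half.integrableOn, add_sub_cancel, normalCDF]
  rw [e]
  exact (h.const_add _).const_mul _

theorem continuous_normalCDF : Continuous normalCDF :=
  continuous_iff_continuousAt.2 fun x => (hasDerivAt_normalCDF x).continuousAt

theorem strictMono_normalCDF : StrictMono normalCDF :=
  strictMono_of_hasDerivAt_pos hasDerivAt_normalCDF fun _ =>
    mul_pos (one_div_pos.2 sqrt_two_pi_pos) (Real.exp_pos _)

/-- Mills' inequality. -/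
theorem mul_one_sub_normalCDF_le (x : ℝ) :
    x * (1 - normalCDF x) ≤ 1 / √(2 * Real.pi) * Real.exp (-x ^ 2 / 2) := by
  have hd : ∀ y : ℝ, HasDerivAt (fun t : ℝ => -Real.exp (-t ^ 2 / 2))
      (y * Real.exp (-y ^ 2 / 2)) y := by
    intro y
    have h := ((((hasDerivAt_id y).pow 2).neg.div_const 2).exp).neg
    refine h.congr_deriv ?_
    simp
    ring
  have hlim : Tendsto (fun t : ℝ => -Real.exp (-t ^ 2 / 2)) atTop (nhds 0) := by
    rw [show (0 : ℝ) = -0 by simp]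
    refine (Real.tendsto_exp_atBot.comp ?_).neg
    have : Tendsto (fun t : ℝ => t ^ 2 / 2) atTop atTop :=
      (tendsto_pow_atTop two_ne_zero).atTop_div_const two_pos
    refine (tendsto_neg_atTop_atBot.comp this).congr fun t => ?_
    simp only [Function.comp]
    ring
  have hi := MeasureTheory.integral_Ioi_of_hasDerivAt_of_tendsto
    (a := x) (hd x).continuousAt.continuousWithinAt
    (fun y _ => hd y) integrable_mul_exp_neg_sq_half.integrableOn hlim
  have hm : ∫ t in Set.Ioi x, x * Real.exp (-t ^ 2 / 2) ≤
      ∫ t in Set.Ioi x, t * Real.exp (-t ^ 2 / 2) :=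
    MeasureTheory.setIntegral_mono_on (integrable_exp_neg_sq_half.const_mul x).integrableOn
      integrable_mul_exp_neg_sq_half.integrableOn measurableSet_Ioi
      fun t ht => mul_le_mul_of_nonneg_right (le_of_lt ht) (Real.exp_pos _).le
  rw [hi, MeasureTheory.integral_const_mul] at hm
  rw [one_sub_normalCDF]
  have := mul_le_mul_of_nonneg_left hm (one_div_pos.2 sqrt_two_pi_pos).le
  linarith

/-- Mills' inequality gives `1 - Φ(2 / e) ≤ e / 2`, which with the symmetry of `Φ` supplies points
on both sides of `y` for the intermediate value theorem. -/
theorem exists_normalCDF_eq {y : ℝ} (hy : y ∈ Set.Ioo (0 : ℝ) 1) : ∃ x, normalCDF x = y := by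
  have key : ∀ e : ℝ, 0 < e → ∃ x, 1 - normalCDF x < e := by
    intro e he
    refine ⟨2 / e, ?_⟩
    have h := mul_one_sub_normalCDF_le (2 / e)
    have h1 : 1 / √(2 * Real.pi) * Real.exp (-(2 / e) ^ 2 / 2) ≤ 1 := by
      have h2 : 1 / √(2 * Real.pi) ≤ 1 := by
        rw [div_le_one sqrt_two_pi_pos]; exact one_le_sqrt_two_pi
      have h3 : Real.exp (-(2 / e) ^ 2 / 2) ≤ 1 := Real.exp_le_one_iff.2 (by
        have := sq_nonneg (2 / e); linarith)
      exact mul_le_one₀ h2 (Real.exp_pos _).le h3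
    have h4 := h.trans h1
    rw [div_mul_eq_mul_div, div_le_one he] at h4
    linarith
  obtain ⟨a, ha⟩ := key y hy.1
  obtain ⟨b, hb⟩ := key (1 - y) (by linarith [hy.2])
  rw [← normalCDF_neg] at ha
  exact mem_range_of_exists_le_of_exists_ge continuous_normalCDF ⟨-a, ha.le⟩ ⟨b, by linarith⟩

theorem normalCDF_normalCDFInv {y : ℝ} (hy : y ∈ Set.Ioo (0 : ℝ) 1) :
    normalCDF (normalCDFInv y) = y :=
  Function.invFun_eq (exists_normalCDF_eq hy)

/-- The derivative of `normalCDF` is bounded below on bounded sets. -/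
theorem exists_normalCDF_add_ge (t : ℝ) :
    ∃ c > 0, ∀ x y, t - 1 ≤ x → x ≤ y → y ≤ t + 1 → normalCDF x + c * (y - x) ≤ normalCDF y := by
  -- Every point of the window has absolute value at most `b`, so the density there is at least its
  -- value at `b`.
  set b := |t| + 1
  refine ⟨1 / √(2 * Real.pi) * Real.exp (-b ^ 2 / 2),
    mul_pos (one_div_pos.2 sqrt_two_pi_pos) (Real.exp_pos _), fun x y hx hxy hy => ?_⟩
  rcases hxy.eq_or_lt with rfl | hlt
  · simp
  obtain ⟨c, hc, h⟩ := exists_hasDerivAt_eq_slope normalCDF _ hlt continuous_normalCDF.continuousOn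
    fun z _ => hasDerivAt_normalCDF z
  rw [eq_div_iff (by linarith)] at h
  have h1 : c ^ 2 ≤ b ^ 2 := sq_le_sq.2 (by
    rw [abs_of_pos (show 0 < b by positivity)]
    refine abs_le.2 ⟨?_, ?_⟩ <;>
    · simp only [b]; linarith [hc.1, hc.2, neg_abs_le t, le_abs_self t])
  have h2 : Real.exp (-b ^ 2 / 2) ≤ Real.exp (-c ^ 2 / 2) := Real.exp_le_exp.2 (by linarith)
  have h3 := mul_le_mul_of_nonneg_right (mul_le_mul_of_nonneg_left h2
    (one_div_pos.2 sqrt_two_pi_pos).le) (sub_nonneg.2 hxy)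
  linarith

/-! ### The Berry–Esseen bound for binomial distributions, by Stein's method -/

theorem exp_mul_one_sub_normalCDF_mul_le (x : ℝ) :
    √(2 * Real.pi) * Real.exp (x ^ 2 / 2) * (1 - normalCDF x) * x ≤ 1 := by
  have h := mul_le_mul_of_nonneg_left (mul_one_sub_normalCDF_le x)
    (mul_pos sqrt_two_pi_pos (Real.exp_pos (x ^ 2 / 2))).le
  have e : Real.exp (x ^ 2 / 2) * Real.exp (-x ^ 2 / 2) = 1 := by
    rw [← Real.exp_add, neg_div, add_neg_cancel, Real.exp_zero]
  have e2 := mul_one_div_cancel sqrt_two_pi_pos.ne'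
  calc _ = √(2 * Real.pi) * Real.exp (x ^ 2 / 2) * (x * (1 - normalCDF x)) := by ring
    _ ≤ _ := h
    _ = (√(2 * Real.pi) * (1 / √(2 * Real.pi))) *
        (Real.exp (x ^ 2 / 2) * Real.exp (-x ^ 2 / 2)) := by ring
    _ = 1 := by rw [e, e2, one_mul]

/-- For `x ≥ 1` Mills' inequality already gives the bound `1`; for `x ≤ 1` the exponential is at
most `√e ≤ 2`. -/
theorem exp_mul_one_sub_normalCDF_le {x : ℝ} (hx : 0 ≤ x) :
    √(2 * Real.pi) * Real.exp (x ^ 2 / 2) * (1 - normalCDF x) ≤ 2 * √(2 * Real.pi) := by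
  have h1 : 0 ≤ 1 - normalCDF x := by linarith [normalCDF_le_one x]
  have h1' : 1 - normalCDF x ≤ 1 := by linarith [normalCDF_nonneg x]
  have hc := sqrt_two_pi_pos
  rcases le_total 1 x with h | h
  · have h2 := exp_mul_one_sub_normalCDF_mul_le x
    have h3 : 0 ≤ √(2 * Real.pi) * Real.exp (x ^ 2 / 2) * (1 - normalCDF x) := by positivity
    nlinarith [one_le_sqrt_two_pi]
  · have h4 : Real.exp (1 / 2) ≤ 2 := by
      have h5 : Real.exp (1 / 2) ^ 2 = Real.exp 1 := by
        rw [← Real.exp_nat_mul]; norm_num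
      nlinarith [Real.exp_one_lt_d9, Real.exp_pos (1 / 2)]
    have h6 : Real.exp (x ^ 2 / 2) ≤ 2 :=
      (Real.exp_le_exp.2 (by nlinarith)).trans h4
    calc _ ≤ √(2 * Real.pi) * 2 * 1 := by gcongr
      _ = _ := by ring

/-- The solution of Stein's equation `f' w - w f w = 1{w ≤ z} - Φ z`. -/
noncomputable def steinSolution (z w : ℝ) : ℝ :=
  √(2 * Real.pi) * Real.exp (w ^ 2 / 2) * (normalCDF (min w z) * (1 - normalCDF (max w z)))

theorem steinSolution_nonneg (z w : ℝ) : 0 ≤ steinSolution z w :=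
  mul_nonneg (by positivity) (mul_nonneg (normalCDF_nonneg _)
    (by linarith [normalCDF_le_one (max w z)]))

/-- Removes `z`: bound one of the two factors by `1` and the other by its value at `w`, using the
reflection `Φ(-x) = 1 - Φ(x)` when `w ≤ 0`. Both uniform bounds on the solution then follow from
Mills' inequality at `|w|`. -/
theorem steinSolution_le_tail (z w : ℝ) :
    steinSolution z w ≤ √(2 * Real.pi) * Real.exp (|w| ^ 2 / 2) * (1 - normalCDF |w|) := by
  rw [sq_abs]
  refine mul_le_mul_of_nonneg_left ?_ (by positivity)
  have h1 : normalCDF (min w z) ≤ normalCDF w :=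
    strictMono_normalCDF.monotone (min_le_left _ _)
  have h2 : normalCDF w ≤ normalCDF (max w z) := strictMono_normalCDF.monotone (le_max_left _ _)
  have h3 := normalCDF_le_one w
  have h4 := normalCDF_le_one (max w z)
  have h5 := normalCDF_nonneg (min w z)
  rcases le_total 0 w with h | h
  · rw [abs_of_nonneg h]
    nlinarith
  · rw [abs_of_nonpos h, normalCDF_neg]
    nlinarith

theorem steinSolution_le (z w : ℝ) : steinSolution z w ≤ 2 * √(2 * Real.pi) :=
  (steinSolution_le_tail z w).trans (exp_mul_one_sub_normalCDF_le (abs_nonneg w))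

theorem abs_mul_steinSolution_le (z w : ℝ) : |w * steinSolution z w| ≤ 1 := by
  rw [abs_mul, abs_of_nonneg (steinSolution_nonneg z w), mul_comm]
  exact (mul_le_mul_of_nonneg_right (steinSolution_le_tail z w) (abs_nonneg w)).trans
    (exp_mul_one_sub_normalCDF_mul_le |w|)

theorem continuous_steinSolution (z : ℝ) : Continuous (steinSolution z) := by
  have := continuous_normalCDF
  unfold steinSolution
  fun_prop

/-- The derivative of `steinSolution z` prescribed by Stein's equation. -/
noncomputable def steinDeriv (z w : ℝ) : ℝ :=
  w * steinSolution z w + ((if w ≤ z then 1 else 0) - normalCDF z)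

theorem abs_steinDeriv_le (z w : ℝ) : |steinDeriv z w| ≤ 2 := by
  have h1 := abs_le.1 (abs_mul_steinSolution_le z w)
  have h2 := normalCDF_nonneg z
  have h3 := normalCDF_le_one z
  rw [steinDeriv, abs_le]
  split_ifs <;> constructor <;> linarith [h1.1, h1.2]

/-- On either side of `z` one of the two `Φ` factors is constant and the product rule applies. At
`z` itself the solution has a kink. -/
theorem hasDerivAt_steinSolution {z w : ℝ} (h : w ≠ z) :
    HasDerivAt (steinSolution z) (steinDeriv z w) w := by
  have hE : HasDerivAt (fun w : ℝ => √(2 * Real.pi) * Real.exp (w ^ 2 / 2))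
      (√(2 * Real.pi) * (Real.exp (w ^ 2 / 2) * w)) w := by
    have h := (((hasDerivAt_id w).pow 2).div_const 2).exp.const_mul √(2 * Real.pi)
    refine h.congr_deriv ?_
    simp
  have e : Real.exp (w ^ 2 / 2) * Real.exp (-w ^ 2 / 2) = 1 := by
    rw [← Real.exp_add, neg_div, add_neg_cancel, Real.exp_zero]
  have e2 := mul_one_div_cancel sqrt_two_pi_pos.ne'
  rcases lt_or_gt_of_ne h with h | h
  · have h1 := hE.mul ((hasDerivAt_normalCDF w).mul_const (1 - normalCDF z))
    refine (h1.congr_deriv ?_).congr_of_eventuallyEq ?_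
    · rw [steinDeriv, if_pos h.le, steinSolution, min_eq_left h.le, max_eq_right h.le]
      linear_combination (1 - normalCDF z) * (√(2 * Real.pi) * (1 / √(2 * Real.pi)) * e + e2)
    · filter_upwards [Iio_mem_nhds h] with y hy
      simp only [Set.mem_Iio] at hy
      simp [steinSolution, min_eq_left hy.le, max_eq_right hy.le]
  · have h1 := hE.mul (((hasDerivAt_normalCDF w).const_sub 1).const_mul (normalCDF z))
    refine (h1.congr_deriv ?_).congr_of_eventuallyEq ?_
    · rw [steinDeriv, if_neg h.not_ge, steinSolution, min_eq_right h.le, max_eq_left h.le]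
      linear_combination (-normalCDF z) * (√(2 * Real.pi) * (1 / √(2 * Real.pi)) * e + e2)
    · filter_upwards [Ioi_mem_nhds h] with y hy
      simp only [Set.mem_Ioi] at hy
      simp [steinSolution, min_eq_right hy.le, max_eq_left hy.le]

theorem exists_steinDeriv_eq_slope {z a b : ℝ} (hab : a < b) (hz : b ≤ z ∨ z ≤ a) :
    ∃ x ∈ Set.Ioo a b, steinSolution z b - steinSolution z a = steinDeriv z x * (b - a) := by
  obtain ⟨x, hx, h⟩ := exists_hasDerivAt_eq_slope (steinSolution z) (steinDeriv z) hab
    (continuous_steinSolution z).continuousOn fun y hy => hasDerivAt_steinSolution (by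
      rintro rfl
      rcases hz with h | h <;> linarith [hy.1, hy.2])
  exact ⟨x, hx, by rw [h, div_mul_cancel₀ _ (by linarith)]⟩

theorem abs_steinSolution_sub_le (z : ℝ) {a b : ℝ} (hab : a ≤ b) :
    |steinSolution z b - steinSolution z a| ≤ 2 * (b - a) := by
  have key : ∀ a b : ℝ, a ≤ b → (b ≤ z ∨ z ≤ a) →
      |steinSolution z b - steinSolution z a| ≤ 2 * (b - a) := by
    intro a b hab hz
    rcases hab.eq_or_lt with rfl | hlt
    · simp
    obtain ⟨x, -, h⟩ := exists_steinDeriv_eq_slope hlt hz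
    rw [h, abs_mul, abs_of_pos (sub_pos.2 hlt)]
    exact mul_le_mul_of_nonneg_right (abs_steinDeriv_le z x) (sub_nonneg.2 hab)
  rcases le_total b z with h | h
  · exact key a b hab (.inl h)
  rcases le_total z a with h' | h'
  · exact key a b hab (.inr h')
  have h1 := key a z h' (.inl le_rfl)
  have h2 := key z b h (.inr le_rfl)
  have h3 := abs_add_le (steinSolution z b - steinSolution z z)
    (steinSolution z z - steinSolution z a)
  rw [sub_add_sub_cancel] at h3
  linarith

/-- When `z` does not separate the points, the indicators cancel and only the increment of `w *
steinSolution z w` remains. -/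
theorem abs_steinDeriv_sub_le {z a x : ℝ} (hax : a ≤ x) (h : a ≤ z ↔ x ≤ z) :
    |steinDeriv z x - steinDeriv z a| ≤ (2 * √(2 * Real.pi) + 2 * |a|) * (x - a) := by
  have e : steinDeriv z x - steinDeriv z a = (x - a) * steinSolution z x +
      a * (steinSolution z x - steinSolution z a) := by
    simp only [steinDeriv, h]
    ring
  rw [e]
  refine (abs_add_le _ _).trans ?_
  rw [abs_mul, abs_mul, abs_of_nonneg (sub_nonneg.2 hax), abs_of_nonneg (steinSolution_nonneg z x)]
  have h1 := mul_le_mul_of_nonneg_left (steinSolution_le z x) (sub_nonneg.2 hax)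
  have h2 := mul_le_mul_of_nonneg_left (abs_steinSolution_sub_le z hax) (abs_nonneg a)
  linarith

/-- The local error in Stein's method on one lattice cell `[a, a + h]`. Away from the kink the slope
is a derivative value inside the cell, so everything varies by `O((1 + |a|) h)`. In the cell that
meets the kink only the crude bound `2 + 2` is available. -/
theorem abs_steinDeriv_average_sub_slope_le {p z a h : ℝ} (hp : p ∈ Set.Icc (0 : ℝ) 1)
    (hh : 0 < h) :
    |(1 - p) * steinDeriv z a + p * steinDeriv z (a + h) -
        (steinSolution z (a + h) - steinSolution z a) / h| ≤
      2 * (2 * √(2 * Real.pi) + 2 * |a|) * h + if a ≤ z ∧ z < a + h then 4 else 0 := by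
  obtain ⟨hp0, hp1⟩ := hp
  have hK : 0 ≤ (2 * √(2 * Real.pi) + 2 * |a|) * h := by positivity
  split_ifs with hz
  · have h1 := abs_le.1 (abs_steinDeriv_le z a)
    have h2 := abs_le.1 (abs_steinDeriv_le z (a + h))
    have h3 := abs_steinSolution_sub_le z (show a ≤ a + h by linarith)
    have h4 : |(steinSolution z (a + h) - steinSolution z a) / h| ≤ 2 := by
      rw [abs_div, abs_of_pos hh, div_le_iff₀ hh]
      linarith
    have h5 := abs_le.1 h4
    rw [abs_le]
    constructor <;> nlinarith
  · have hz' : a + h ≤ z ∨ z ≤ a ∧ ¬ a ≤ z := by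
      by_cases h1 : a ≤ z
      · exact .inl (not_lt.1 fun h2 => hz ⟨h1, h2⟩)
      · exact .inr ⟨(not_le.1 h1).le, h1⟩
    obtain ⟨x, hx, hs⟩ := exists_steinDeriv_eq_slope (show a < a + h by linarith)
      (hz'.imp_right And.left)
    have hiff : ∀ y, a ≤ y → y ≤ a + h → (a ≤ z ↔ y ≤ z) := by
      intro y hy1 hy2
      rcases hz' with h1 | ⟨_, h1⟩
      · exact ⟨fun _ => hy2.trans h1, fun _ => by linarith⟩
      · exact ⟨fun h2 => absurd h2 h1, fun h2 => hy1.trans h2⟩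
    have h1 := abs_steinDeriv_sub_le hx.1.le (hiff x hx.1.le hx.2.le)
    have h2 := abs_steinDeriv_sub_le (show a ≤ a + h by linarith)
      (hiff (a + h) (by linarith) le_rfl)
    rw [add_sub_cancel_left] at h2 hs
    have h3 : |steinDeriv z x - steinDeriv z a| ≤ (2 * √(2 * Real.pi) + 2 * |a|) * h :=
      h1.trans (mul_le_mul_of_nonneg_left (by linarith [hx.2]) (by positivity))
    rw [hs, mul_div_cancel_right₀ _ hh.ne']
    have h4 := abs_le.1 h2
    have h5 := abs_le.1 h3
    rw [abs_le]
    constructor <;> nlinarith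

/-- The Berry–Esseen bound for binomial distributions. -/
theorem abs_binomialMean_sub_normalCDF_le {n : ℕ} {p : ℝ} (hp : p ∈ Set.Ioo (0 : ℝ) 1) {s : ℝ}
    (hs : s = √((n + 1) * p * (1 - p))) (hs1 : 1 ≤ s) (z : ℝ) :
    |binomialMean (n + 1) p (fun j => if ((j : ℝ) - (n + 1) * p) / s ≤ z then 1 else 0) -
      normalCDF z| ≤ (4 * √(2 * Real.pi) + 12) / s := by
  have hp' : p ∈ Set.Icc (0 : ℝ) 1 := ⟨hp.1.le, hp.2.le⟩
  have hp0 := hp.1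
  have hq : 0 < 1 - p := by linarith [hp.2]
  have hs0 : 0 < s := by linarith
  have hss : ((n : ℝ) + 1) * p * (1 - p) = s ^ 2 := by
    rw [hs, Real.sq_sqrt (by positivity)]
  set a : ℕ → ℝ := fun j => ((j : ℝ) - (n + 1) * p) / s with ha
  have ha1 : ∀ j, a (j + 1) = a j + 1 / s := fun j => by simp only [ha]; push_cast; ring
  -- Stein's identity for the standardized variable: a unit step in `j` is a step `1 / s` in `a j`.
  have hstein : binomialMean (n + 1) p (fun j => a j * steinSolution z (a j)) =
      binomialMean n p fun j => (steinSolution z (a j + 1 / s) - steinSolution z (a j)) / (1 / s) := by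
    have h := binomialMean_stein n p fun j => 1 / s * steinSolution z (a j)
    rw [hss, ← binomialMean_const_mul] at h
    convert h using 2
    · funext j; simp only [ha]; ring
    · funext j; rw [ha1]; field_simp
  -- Take the mean of Stein's equation, and condition the derivative term on the last trial so that
  -- both terms are means over `n` trials.
  have hmain : binomialMean (n + 1) p (fun j => if a j ≤ z then 1 else 0) - normalCDF z =
      binomialMean n p fun j => (1 - p) * steinDeriv z (a j) + p * steinDeriv z (a j + 1 / s) -
        (steinSolution z (a j + 1 / s) - steinSolution z (a j)) / (1 / s) := by
    rw [binomialMean_sub, ← hstein]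
    have h := binomialMean_succ n p fun j => steinDeriv z (a j)
    simp only [ha1] at h
    rw [← h]
    simp only [steinDeriv, binomialMean_add, binomialMean_sub, binomialMean_const]
    ring
  rw [hmain]
  refine (abs_binomialMean_le hp' _).trans ((binomialMean_mono hp' fun j _ =>
    abs_steinDeriv_average_sub_slope_le hp' (one_div_pos.2 hs0)).trans ?_)
  rw [binomialMean_add]
  have habs : binomialMean n p (fun j => |a j|) ≤ 2 := by
    -- `a` is centred at `(n + 1) p` but the mean is over `n` trials; the shift `p / s` is at most
    -- `1`.
    have h1 : ∀ j ≤ n, |a j| ≤ 1 / s * |(j : ℝ) - n * p| + 1 := by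
      intro j _
      have e : a j = 1 / s * ((j : ℝ) - n * p) + -(1 / s * p) := by simp only [ha]; ring
      have h2 : |1 / s * p| ≤ 1 := by
        rw [abs_of_pos (by positivity)]
        exact mul_le_one₀ (by rw [div_le_one hs0]; exact hs1) hp'.1 hp'.2
      rw [e]
      refine (abs_add_le _ _).trans ?_
      rw [abs_neg, abs_mul, abs_of_pos (one_div_pos.2 hs0)]
      linarith
    refine (binomialMean_mono hp' h1).trans ?_
    rw [binomialMean_add, binomialMean_const, binomialMean_const_mul]
    have h3 : binomialMean n p (fun j => |(j : ℝ) - n * p|) ≤ s := by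
      refine (binomialMean_abs_deviation_le hp').trans ?_
      rw [hs]
      exact Real.sqrt_le_sqrt (by gcongr; linarith)
    have h4 := mul_le_mul_of_nonneg_left h3 (one_div_pos.2 hs0).le
    rw [one_div_mul_cancel hs0.ne'] at h4
    linarith
  -- Only one lattice cell can contain `z`, so the crude bound is paid with the probability of a
  -- single point.
  have hbad : binomialMean n p (fun j => if a j ≤ z ∧ z < a j + 1 / s then 4 else 0) ≤ 4 / s := by
    have h1 := binomialMean_point_le (n := n) hp ⌊(n + 1) * p + z * s⌋₊
    rw [← hs] at h1
    refine le_trans (binomialMean_mono hp' (h := fun j =>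
      4 * if j = ⌊((n : ℝ) + 1) * p + z * s⌋₊ then 1 else 0) fun j _ => ?_) ?_
    · by_cases hz : a j ≤ z ∧ z < a j + 1 / s
      · rw [if_pos hz, if_pos, mul_one]
        obtain ⟨h2, h3⟩ := hz
        rw [← ha1] at h3
        simp only [ha] at h2 h3
        rw [div_le_iff₀ hs0] at h2
        rw [lt_div_iff₀ hs0] at h3
        push_cast at h3
        symm
        rw [Nat.floor_eq_iff (by linarith [j.cast_nonneg (α := ℝ)])]
        constructor <;> linarith
      · rw [if_neg hz]
        split_ifs <;> norm_num
    · rw [binomialMean_const_mul]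
      calc _ ≤ 4 * (1 / s) := by linarith
        _ = _ := by ring
  have hfirst : binomialMean n p (fun j => 2 * (2 * √(2 * Real.pi) + 2 * |a j|) * (1 / s)) ≤
      (4 * √(2 * Real.pi) + 8) / s := by
    have e : (fun j => 2 * (2 * √(2 * Real.pi) + 2 * |a j|) * (1 / s)) = fun j =>
        4 * √(2 * Real.pi) / s + 4 / s * |a j| := by funext j; ring
    rw [e, binomialMean_add, binomialMean_const, binomialMean_const_mul]
    have h1 := mul_le_mul_of_nonneg_left habs (show 0 ≤ 4 / s by positivity)
    calc _ ≤ 4 * √(2 * Real.pi) / s + 4 / s * 2 := by linarith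
      _ = _ := by ring
  calc _ ≤ (4 * √(2 * Real.pi) + 8) / s + 4 / s := add_le_add hfirst hbad
    _ = _ := by ring

/-! ### Sorting the errors of the erasure channel -/

theorem PauliNoise.probOf_eq_expect {n : ℕ} {V : Type*} [Fintype V] (p : PauliNoise n V)
    (E : PauliVec n → V → Prop) [∀ u v, Decidable (E u v)] :
    p.probOf E = p.expect fun u v => if E u v then 1 else 0 := by
  unfold probOf expect
  refine Finset.sum_congr rfl fun u _ => Finset.sum_congr rfl fun v _ => ?_
  by_cases h : E u v <;> simp [h]

/-- A bound for the probability that an error is confused with one of the `j` more likely errors. -/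
noncomputable def guessErrorBound (m j : ℕ) : ℝ :=
  if 2 ^ m < j + 1 then 1 else j / 2 ^ m

theorem PauliNoise.achievabilityBound_eq_expect {n : ℕ} {V : Type*} [Fintype V]
    (p : PauliNoise n V) (ord : V → Fin (2 ^ (2 * n)) ≃ PauliVec n) (k : ℕ) :
    p.achievabilityBound ord k =
      p.expect fun u v => guessErrorBound (n - k) ((ord v).symm u) := by
  rw [achievabilityBound, probOf_eq_expect]
  simp only [expect, ← Finset.sum_add_distrib, ← mul_add]
  refine Finset.sum_congr rfl fun u _ => Finset.sum_congr rfl fun v _ => ?_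
  congr 1
  by_cases h : 2 ^ (n - k) < position ord u v
  · rw [if_pos h, if_neg (not_le.2 h), add_zero]
    exact (if_pos h).symm
  · rw [if_neg h, if_pos (not_lt.1 h), zero_add, position, Nat.cast_add, Nat.cast_one,
      add_sub_cancel_right]
    exact (if_neg h).symm

/-- The number of erased qubits. -/
def erasureCount {n : ℕ} (v : Fin n → ZMod 2) : ℕ :=
  (Finset.univ.filter fun i => v i ≠ 0).card

/-- The errors that vanish on all qubits that are not erased. -/
def IsErasureError {n : ℕ} (v : Fin n → ZMod 2) (u : PauliVec n) : Prop :=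
  ∀ i, v i = 0 → u.xPart i = 0 ∧ u.zPart i = 0

instance {n : ℕ} (v : Fin n → ZMod 2) : DecidablePred (IsErasureError v) := fun u =>
  inferInstanceAs (Decidable (∀ i, v i = 0 → u.xPart i = 0 ∧ u.zPart i = 0))

theorem prod_ite_erased {R : Type*} [CommMonoid R] {n : ℕ} (v : Fin n → ZMod 2) (a b : R) :
    ∏ i, (if v i = 0 then a else b) = a ^ (n - erasureCount v) * b ^ erasureCount v := by
  have h := Finset.card_filter_add_card_filter_not (s := (Finset.univ : Finset (Fin n)))
    (fun i => v i = 0)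
  rw [Finset.card_univ, Fintype.card_fin] at h
  rw [Finset.prod_ite, Finset.prod_const, Finset.prod_const, erasureCount]
  congr 2
  simp only [ne_eq]
  omega

theorem erasureNoise_mass {n : ℕ} (δ : ℝ) (hδ : δ ∈ Set.Icc (0 : ℝ) 1) (u : PauliVec n)
    (v : Fin n → ZMod 2) :
    (erasureNoise n δ hδ).mass u v = if IsErasureError v u then
      (1 - δ) ^ (n - erasureCount v) * (δ / 4) ^ erasureCount v else 0 := by
  change ∏ i, erasureWeight δ (u.xPart i) (u.zPart i) (v i) = _
  split_ifs with h
  · rw [← prod_ite_erased]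
    refine Finset.prod_congr rfl fun i _ => ?_
    unfold erasureWeight
    split_ifs with h1 h2
    · rfl
    · exact absurd (h i h1) h2
    · rfl
  · simp only [IsErasureError, not_forall] at h
    obtain ⟨i, h1, h2⟩ := h
    refine Finset.prod_eq_zero (Finset.mem_univ i) ?_
    simp only [erasureWeight]
    rw [if_pos h1, if_neg h2]

/-- The indicator is a product over qubits, with `4` choices on an erased qubit and `1` elsewhere.
-/
theorem card_isErasureError {n : ℕ} (v : Fin n → ZMod 2) :
    (Finset.univ.filter (IsErasureError v)).card = 4 ^ erasureCount v := by
  have h := sum_prod_pauliVec (R := ℕ) n fun i x z => if v i = 0 → x = 0 ∧ z = 0 then 1 else 0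
  rw [Finset.card_filter]
  calc _ = ∑ u : PauliVec n, ∏ i, (if v i = 0 → u.xPart i = 0 ∧ u.zPart i = 0 then 1 else 0) := by
        refine Finset.sum_congr rfl fun u _ => ?_
        rw [Finset.prod_ite_zero]
        simp only [IsErasureError, Finset.mem_univ, forall_const, Finset.prod_const_one]
        congr
    _ = ∏ i, (if v i = 0 then 1 else 4) := by
        rw [h]
        refine Finset.prod_congr rfl fun i _ => ?_
        by_cases hi : v i = 0
        · simp only [hi, forall_const, if_true]; decide
        · simp only [hi, IsEmpty.forall_iff, if_true, if_false]; decide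
    _ = _ := by rw [prod_ite_erased, one_pow, one_mul]

/-- An antitone function with the two values `c > 0` and `0` equals `c` exactly on an initial
segment, of length `S.card`. This is why the resolution of ties is irrelevant. -/
theorem sum_antitone_ite_mul {N : ℕ} {f : Fin N → ℝ} (hf : Antitone f) {c : ℝ} (hc : 0 ≤ c)
    {S : Finset (Fin N)} (hS : ∀ j, f j = if j ∈ S then c else 0) (h : ℕ → ℝ) :
    ∑ j, f j * h j = c * ∑ j ∈ Finset.range S.card, h j := by
  rcases hc.eq_or_lt with rfl | hc
  · simp [hS]
  have hlow : ∀ i j, i ≤ j → j ∈ S → i ∈ S := by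
    intro i j hij hj
    by_contra hi
    have := hf hij
    rw [hS, hS, if_pos hj, if_neg hi] at this
    linarith
  have hmem : ∀ j, j ∈ S ↔ (j : ℕ) < S.card := by
    intro j
    refine ⟨fun hj => ?_, fun hj => ?_⟩
    · have := Finset.card_le_card (s := Finset.Iic j) (t := S)
        fun i hi => hlow i j (Finset.mem_Iic.1 hi) hj
      rw [Fin.card_Iic] at this
      omega
    · by_contra hj'
      have := Finset.card_le_card (s := S) (t := Finset.Iio j) fun i hi =>
        Finset.mem_Iio.2 (lt_of_not_ge fun hji => hj' (hlow j i hji hi))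
      rw [Fin.card_Iio] at this
      omega
  have hcard : S.card ≤ N := by simpa using S.card_le_univ
  calc ∑ j, f j * h j = ∑ j : Fin N, if (j : ℕ) < S.card then c * h j else 0 := by
        refine Finset.sum_congr rfl fun j _ => ?_
        rw [hS]
        simp only [hmem]
        split_ifs <;> simp
    _ = ∑ j ∈ Finset.range N, if j < S.card then c * h j else 0 :=
        Fin.sum_univ_eq_sum_range (fun j => if j < S.card then c * h j else 0) N
    _ = ∑ j ∈ Finset.range S.card, c * h j := by
        rw [← Finset.sum_filter]
        refine Finset.sum_congr ?_ fun _ _ => rfl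
        ext j
        simp only [Finset.mem_filter, Finset.mem_range]
        omega
    _ = _ := by rw [Finset.mul_sum]

theorem sum_erasureCount {n : ℕ} (F : ℕ → ℝ) :
    ∑ v : Fin n → ZMod 2, F (erasureCount v) = ∑ e ∈ Finset.range (n + 1), n.choose e * F e := by
  have h := Finset.sum_powerset_apply_card F (x := (Finset.univ : Finset (Fin n)))
  simp only [Finset.powerset_univ, Finset.card_univ, Fintype.card_fin, nsmul_eq_mul] at h
  rw [← h]
  refine Fintype.sum_bijective (fun v : Fin n → ZMod 2 => Finset.univ.filter fun i => v i ≠ 0)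
    ⟨fun v w hvw => ?_, fun s => ⟨fun i => if i ∈ s then 1 else 0, ?_⟩⟩ _ _ fun v => rfl
  · funext i
    have h1 := Finset.ext_iff.1 hvw i
    simp only [Finset.mem_filter, Finset.mem_univ, true_and] at h1
    revert h1
    generalize v i = a
    generalize w i = b
    revert a b
    decide
  · ext i
    simp

/-- Given `e` erasures the index `J - 1` is uniform on `{0, …, 4 ^ e - 1}`; averaging over `e`
leaves no trace of `ord`. -/
theorem erasureNoise_expect_position {n : ℕ} {δ : ℝ} (hδ : δ ∈ Set.Icc (0 : ℝ) 1)
    {ord : (Fin n → ZMod 2) → Fin (2 ^ (2 * n)) ≃ PauliVec n}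
    (hord : (erasureNoise n δ hδ).IsSorting ord) (h : ℕ → ℝ) :
    (erasureNoise n δ hδ).expect (fun u v => h ((ord v).symm u)) =
      binomialMean n δ fun e => 1 / 4 ^ e * ∑ j ∈ Finset.range (4 ^ e), h j := by
  have hv : ∀ v, ∑ u, (erasureNoise n δ hδ).mass u v * h ((ord v).symm u) =
      (1 - δ) ^ (n - erasureCount v) * (δ / 4) ^ erasureCount v *
        ∑ j ∈ Finset.range (4 ^ erasureCount v), h j := by
    intro v
    have hS := card_isErasureError v
    rw [← Finset.card_map (ord v).symm.toEmbedding] at hS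
    rw [← Equiv.sum_comp (ord v), ← hS]
    simp only [Equiv.symm_apply_apply]
    have h0 := hδ.1
    have h1 : 0 ≤ 1 - δ := by linarith [hδ.2]
    refine sum_antitone_ite_mul (hord v) (by positivity) (fun j => ?_) h
    rw [erasureNoise_mass]
    simp
  rw [PauliNoise.expect, Finset.sum_comm]
  simp only [hv]
  rw [sum_erasureCount fun e => (1 - δ) ^ (n - e) * (δ / 4) ^ e *
    ∑ j ∈ Finset.range (4 ^ e), h j, binomialMean]
  refine Finset.sum_congr rfl fun e _ => ?_
  rw [div_pow]
  ring

theorem sum_range_ite_lt {M K : ℕ} (hMK : M ≤ K) (a : ℕ → ℝ) :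
    ∑ j ∈ Finset.range K, (if M < j + 1 then 1 else a j) =
      ∑ j ∈ Finset.range M, a j + (K - M) := by
  induction K, hMK using Nat.le_induction with
  | base =>
    rw [sub_self, add_zero]
    exact Finset.sum_congr rfl fun j hj => if_neg (by have := Finset.mem_range.1 hj; omega)
  | succ K hK ih =>
    rw [Finset.sum_range_succ, ih, if_pos (by omega)]
    push_cast
    ring

theorem sum_range_ite_lt_of_le {M K : ℕ} (hKM : K ≤ M) (a : ℕ → ℝ) :
    ∑ j ∈ Finset.range K, (if M < j + 1 then 1 else a j) = ∑ j ∈ Finset.range K, a j :=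
  Finset.sum_congr rfl fun j hj => if_neg (by have := Finset.mem_range.1 hj; omega)

theorem sum_range_div (K : ℕ) (M : ℝ) :
    ∑ j ∈ Finset.range K, (j : ℝ) / M = K * (K - 1) / (2 * M) := by
  induction K with
  | zero => simp
  | succ K ih =>
    rw [Finset.sum_range_succ, ih, div_add_div_eq_of_two_mul]
    push_cast
    ring
where
  div_add_div_eq_of_two_mul {a b M : ℝ} : a / (2 * M) + b / M = (a + 2 * b) / (2 * M) := by
    rcases eq_or_ne M 0 with rfl | h
    · simp
    · field_simp

/-! ### The bounds conditioned on the number of erasures. -/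

theorem two_pow_le_four_pow {m e : ℕ} (h : m < 2 * e) : 2 ^ m ≤ 4 ^ e := by
  rw [show 4 = 2 ^ 2 by norm_num, ← pow_mul]
  exact Nat.pow_le_pow_right (by norm_num) h.le

theorem four_pow_le_two_pow {m e : ℕ} (h : ¬ m < 2 * e) : 4 ^ e ≤ 2 ^ m := by
  rw [show 4 = 2 ^ 2 by norm_num, ← pow_mul]
  exact Nat.pow_le_pow_right (by norm_num) (not_lt.1 h)

/-- The converse bound given the number `e` of erasures, where `m = n - k`. -/
noncomputable def converseTerm (m e : ℕ) : ℝ :=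
  if m < 2 * e then 1 - 2 ^ m * (1 / 4 ^ e) else 0

/-- The achievability bound given the number `e` of erasures, where `m = n - k`. -/
noncomputable def achievabilityTerm (m e : ℕ) : ℝ :=
  if m < 2 * e then 1 - (2 ^ m + 1) / 2 * (1 / 4 ^ e) else (4 ^ e - 1) / 2 ^ (m + 1)

theorem erasureNoise_converseBound {n : ℕ} {δ : ℝ} (hδ : δ ∈ Set.Icc (0 : ℝ) 1)
    {ord : (Fin n → ZMod 2) → Fin (2 ^ (2 * n)) ≃ PauliVec n}
    (hord : (erasureNoise n δ hδ).IsSorting ord) (k : ℕ) :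
    (erasureNoise n δ hδ).converseBound ord k = binomialMean n δ (converseTerm (n - k)) := by
  rw [PauliNoise.converseBound, PauliNoise.probOf_eq_expect]
  refine (erasureNoise_expect_position hδ hord fun j => if 2 ^ (n - k) < j + 1 then 1 else 0).trans
    (binomialMean_congr fun e _ => ?_)
  rw [converseTerm]
  split_ifs with h
  · rw [sum_range_ite_lt (two_pow_le_four_pow h) fun _ => 0, Finset.sum_const_zero]
    push_cast
    field_simp
    ring
  · rw [sum_range_ite_lt_of_le (four_pow_le_two_pow h) fun _ => 0, Finset.sum_const_zero, mul_zero]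

theorem erasureNoise_achievabilityBound {n : ℕ} {δ : ℝ} (hδ : δ ∈ Set.Icc (0 : ℝ) 1)
    {ord : (Fin n → ZMod 2) → Fin (2 ^ (2 * n)) ≃ PauliVec n}
    (hord : (erasureNoise n δ hδ).IsSorting ord) (k : ℕ) :
    (erasureNoise n δ hδ).achievabilityBound ord k =
      binomialMean n δ (achievabilityTerm (n - k)) := by
  have e' := erasureNoise_expect_position hδ hord (guessErrorBound (n - k))
  refine ((PauliNoise.achievabilityBound_eq_expect _ ord k).trans e').trans
    (binomialMean_congr fun e _ => ?_)
  set m := n - k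
  simp only [guessErrorBound]
  rw [achievabilityTerm]
  split_ifs with h
  · rw [sum_range_ite_lt (two_pow_le_four_pow h) fun j => (j : ℝ) / 2 ^ m, sum_range_div]
    push_cast
    field_simp
    ring
  · rw [sum_range_ite_lt_of_le (four_pow_le_two_pow h) fun j => (j : ℝ) / 2 ^ m, sum_range_div]
    push_cast
    rw [pow_succ]
    field_simp

/-! ### The bounds in terms of binomial distribution functions -/

/-- Counting the qubits that are not erased turns the upper tail into a lower tail, with success
probability `1 - p`. -/
theorem binomialMean_ite_lt (n M : ℕ) (p : ℝ) (g : ℕ → ℝ) :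
    binomialMean n p (fun e => if M < e then g e else 0) =
      ∑ j ∈ Finset.range (n - M), (n.choose j : ℝ) * (1 - p) ^ j * (p ^ (n - j) * g (n - j)) := by
  rw [binomialMean, ← Finset.sum_range_reflect]
  have hsub : Finset.range (n - M) ⊆ Finset.range (n + 1) :=
    Finset.range_subset_range.2 (by omega)
  rw [← Finset.sum_subset hsub]
  · refine Finset.sum_congr rfl fun j hj => ?_
    have hj' := Finset.mem_range.1 hj
    rw [show n + 1 - 1 - j = n - j by omega, if_pos (by omega), Nat.choose_symm (by omega),
      show n - (n - j) = j by omega]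
    ring
  · intro j hj hj'
    rw [Finset.mem_range] at hj hj'
    rw [if_neg (by omega), mul_zero]

theorem binomialMean_ite_not_lt {n M : ℕ} (hM : M ≤ n) (p : ℝ) (g : ℕ → ℝ) :
    binomialMean n p (fun e => if M < e then 0 else g e) =
      ∑ j ∈ Finset.range (M + 1), (n.choose j : ℝ) * p ^ j * (1 - p) ^ (n - j) * g j := by
  have hsub : Finset.range (M + 1) ⊆ Finset.range (n + 1) :=
    Finset.range_subset_range.2 (by omega)
  rw [binomialMean, ← Finset.sum_subset hsub]
  · refine Finset.sum_congr rfl fun j hj => ?_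
    have hj' := Finset.mem_range.1 hj
    rw [if_neg (by omega)]
  · intro j hj hj'
    rw [Finset.mem_range] at hj hj'
    rw [if_pos (by omega), mul_zero]

theorem toNat_sub_sub_one_add_one {n M : ℕ} : ((n : ℤ) - (M : ℕ) - 1 + 1).toNat = n - M := by
  omega

theorem binomialCDF_one_sub (n M : ℕ) (δ : ℝ) :
    binomialCDF n (1 - δ) ((n : ℤ) - (M : ℕ) - 1) =
      binomialMean n δ fun e => if M < e then 1 else 0 := by
  rw [binomialMean_ite_lt n M δ fun _ => 1, binomialCDF, toNat_sub_sub_one_add_one]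
  refine Finset.sum_congr rfl fun j _ => ?_
  rw [sub_sub_cancel, mul_one]

theorem pow_mul_binomial_term {n j : ℕ} (hj : j ≤ n) (A q c : ℝ) :
    A ^ n * (c * q ^ j * (1 - q) ^ (n - j)) = c * (A * q) ^ j * (A * (1 - q)) ^ (n - j) := by
  rw [← pow_mul_pow_sub A hj, mul_pow, mul_pow]
  ring

/-- Exponential tilting: `4 ^ (-e)` changes the weights `1 - δ` and `δ / 4`, whose sum `(4 - 3 * δ)
/ 4` is the normalization. -/
theorem binomialCDF_quarter (n M : ℕ) {δ : ℝ} (hδ : δ ∈ Set.Icc (0 : ℝ) 1) :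
    ((4 - 3 * δ) / 4) ^ n *
        binomialCDF n ((4 - 4 * δ) / (4 - 3 * δ)) ((n : ℤ) - (M : ℕ) - 1) =
      binomialMean n δ fun e => if M < e then 1 / 4 ^ e else 0 := by
  have h0 : 4 - 3 * δ ≠ 0 := by linarith [hδ.2]
  rw [binomialMean_ite_lt n M δ fun e => 1 / 4 ^ e, binomialCDF, toNat_sub_sub_one_add_one,
    Finset.mul_sum]
  refine Finset.sum_congr rfl fun j hj => ?_
  rw [pow_mul_binomial_term (by have := Finset.mem_range.1 hj; omega),
    show (4 - 3 * δ) / 4 * ((4 - 4 * δ) / (4 - 3 * δ)) = 1 - δ by field_simp,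
    show (4 - 3 * δ) / 4 * (1 - (4 - 4 * δ) / (4 - 3 * δ)) = δ / 4 by field_simp; ring, div_pow]
  ring

/-- The opposite tilt: the weights are `1 - δ` and `4 * δ`, with sum `1 + 3 * δ`. -/
theorem binomialCDF_four {n M : ℕ} (hM : M ≤ n) {δ : ℝ} (hδ : δ ∈ Set.Icc (0 : ℝ) 1) :
    (1 + 3 * δ) ^ n * binomialCDF n (4 * δ / (1 + 3 * δ)) (M : ℤ) =
      binomialMean n δ fun e => if M < e then 0 else 4 ^ e := by
  have h0 : 1 + 3 * δ ≠ 0 := by linarith [hδ.1]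
  rw [binomialMean_ite_not_lt hM δ fun e => 4 ^ e, binomialCDF,
    show ((M : ℤ) + 1).toNat = M + 1 by omega, Finset.mul_sum]
  refine Finset.sum_congr rfl fun j hj => ?_
  rw [pow_mul_binomial_term (by have := Finset.mem_range.1 hj; omega),
    show (1 + 3 * δ) * (4 * δ / (1 + 3 * δ)) = 4 * δ by field_simp,
    show (1 + 3 * δ) * (1 - 4 * δ / (1 + 3 * δ)) = 1 - δ by field_simp; ring, mul_pow]
  ring

theorem binomialMean_converseTerm (n m : ℕ) {δ : ℝ} (hδ : δ ∈ Set.Icc (0 : ℝ) 1) :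
    binomialMean n δ (converseTerm m) =
      binomialCDF n (1 - δ) ((n : ℤ) - (m / 2 : ℕ) - 1)
        - 2 ^ m * ((4 - 3 * δ) / 4) ^ n *
          binomialCDF n ((4 - 4 * δ) / (4 - 3 * δ)) ((n : ℤ) - (m / 2 : ℕ) - 1) := by
  rw [mul_assoc, binomialCDF_quarter n _ hδ, binomialCDF_one_sub, ← binomialMean_const_mul,
    ← binomialMean_sub]
  refine binomialMean_congr fun e _ => ?_
  rw [converseTerm]
  by_cases h : m < 2 * e
  · rw [if_pos h, if_pos (by omega), if_pos (by omega)]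
  · rw [if_neg h, if_neg (by omega), if_neg (by omega), mul_zero, sub_zero]

theorem binomialMean_achievabilityTerm {n m : ℕ} (hm : m ≤ n) {δ : ℝ}
    (hδ : δ ∈ Set.Icc (0 : ℝ) 1) :
    binomialMean n δ (achievabilityTerm m) =
      (1 + 1 / 2 ^ (m + 1)) * binomialCDF n (1 - δ) ((n : ℤ) - (m / 2 : ℕ) - 1)
        - 1 / 2 ^ (m + 1)
        - (2 ^ m + 1) / 2 * ((4 - 3 * δ) / 4) ^ n *
          binomialCDF n ((4 - 4 * δ) / (4 - 3 * δ)) ((n : ℤ) - (m / 2 : ℕ) - 1)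
        + (1 + 3 * δ) ^ n / 2 ^ (m + 1) *
          binomialCDF n (4 * δ / (1 + 3 * δ)) ((m / 2 : ℕ) : ℤ) := by
  -- The constant `-1 / 2 ^ (m + 1)` belongs only to `e ≤ m / 2`; it is subtracted for every `e` and
  -- restored by the extra `1 / 2 ^ (m + 1)` in the first coefficient.
  have e : binomialMean n δ (achievabilityTerm m) = binomialMean n δ fun e =>
      (1 + 1 / 2 ^ (m + 1)) * (if m / 2 < e then 1 else 0) - 1 / 2 ^ (m + 1) -
        (2 ^ m + 1) / 2 * (if m / 2 < e then 1 / 4 ^ e else 0) +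
        1 / 2 ^ (m + 1) * (if m / 2 < e then 0 else 4 ^ e) := by
    refine binomialMean_congr fun e _ => ?_
    rw [achievabilityTerm]
    by_cases h : m < 2 * e
    · have h' : m / 2 < e := by omega
      simp only [if_pos h, if_pos h']
      ring
    · have h' : ¬ m / 2 < e := by omega
      simp only [if_neg h, if_neg h']
      ring
  rw [e, binomialMean_add, binomialMean_sub, binomialMean_sub, binomialMean_const_mul,
    binomialMean_const_mul, binomialMean_const_mul, binomialMean_const, ← binomialCDF_one_sub,
    ← binomialCDF_quarter n _ hδ, ← binomialCDF_four (by omega) hδ]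
  ring

/-! ### Random symplectic matrices -/

/-- The bilinear form of the reverse diagonal. -/
def revForm {n : ℕ} (x y : PauliVec n) : ZMod 2 :=
  ∑ i, x i * y (Fin.rev i)

theorem revForm_eq_dotProduct {n : ℕ} (x y : PauliVec n) :
    revForm x y = x ⬝ᵥ (revDiag (2 * n)).mulVec y := by
  simp [revForm, revDiag, Matrix.mulVec, dotProduct]

theorem revForm_comm {n : ℕ} (x y : PauliVec n) : revForm x y = revForm y x := by
  refine Fintype.sum_equiv Fin.revPerm _ _ fun i => ?_
  simp [mul_comm]

theorem revForm_add_left {n : ℕ} (x y z : PauliVec n) :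
    revForm (x + y) z = revForm x z + revForm y z := by
  simp [revForm, add_mul, Finset.sum_add_distrib]

theorem revForm_add_right {n : ℕ} (x y z : PauliVec n) :
    revForm x (y + z) = revForm x y + revForm x z := by
  simp [revForm, mul_add, Finset.sum_add_distrib]

theorem revForm_smul_left {n : ℕ} (c : ZMod 2) (x y : PauliVec n) :
    revForm (c • x) y = c * revForm x y := by
  simp [revForm, Finset.mul_sum, mul_assoc]

theorem revForm_smul_right {n : ℕ} (c : ZMod 2) (x y : PauliVec n) :
    revForm x (c • y) = c * revForm x y := by
  rw [revForm_comm, revForm_smul_left, revForm_comm]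

/-- The terms at `i` and `Fin.rev i` agree and cancel modulo `2`; since `2 * n` is even, no index is
its own reverse. -/
theorem revForm_self {n : ℕ} (x : PauliVec n) : revForm x x = 0 := by
  refine Finset.sum_involution (fun i _ => Fin.rev i) (fun i _ => ?_) (fun i _ _ h => ?_)
    (fun i _ => Finset.mem_univ _) (fun i _ => Fin.rev_rev i)
  · rw [Fin.rev_rev, mul_comm (x (Fin.rev i))]
    exact CharTwo.add_self_eq_zero _
  · have := congrArg Fin.val h
    rw [Fin.val_rev] at this
    omega

theorem mem_symplecticMatrices_iff {n : ℕ} {C : Matrix (Fin (2 * n)) (Fin (2 * n)) (ZMod 2)} :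
    C ∈ symplecticMatrices n ↔ ∀ x y : PauliVec n,
      revForm (C.mulVec x) (C.mulVec y) = revForm x y := by
  have key : ∀ x y : PauliVec n, revForm (C.mulVec x) (C.mulVec y) =
      x ⬝ᵥ (C.transpose * revDiag (2 * n) * C).mulVec y := by
    intro x y
    rw [revForm_eq_dotProduct, ← Matrix.mulVec_mulVec, ← Matrix.mulVec_mulVec,
      Matrix.dotProduct_mulVec x, Matrix.vecMul_transpose]
  constructor
  · intro h x y
    rw [key, h, revForm_eq_dotProduct]
  · intro h
    change _ = _
    ext i j
    have := h (Pi.single i 1) (Pi.single j 1)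
    rw [key, revForm_eq_dotProduct] at this
    simpa using this

theorem one_mem_symplecticMatrices (n : ℕ) : 1 ∈ symplecticMatrices n :=
  mem_symplecticMatrices_iff.2 fun x y => by simp

theorem mul_mem_symplecticMatrices {n : ℕ} {B C : Matrix (Fin (2 * n)) (Fin (2 * n)) (ZMod 2)}
    (hB : B ∈ symplecticMatrices n) (hC : C ∈ symplecticMatrices n) :
    B * C ∈ symplecticMatrices n := by
  rw [mem_symplecticMatrices_iff] at *
  intro x y
  rw [← Matrix.mulVec_mulVec, ← Matrix.mulVec_mulVec, hB, hC]

/-- The form is nondegenerate: pairing with the basis vector at `Fin.rev i` reads off coordinate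
`i`. -/
theorem eq_zero_of_mulVec_eq_zero {n : ℕ} {C : Matrix (Fin (2 * n)) (Fin (2 * n)) (ZMod 2)}
    (hC : C ∈ symplecticMatrices n) {x : PauliVec n} (hx : C.mulVec x = 0) : x = 0 := by
  rw [mem_symplecticMatrices_iff] at hC
  funext i
  have h := hC x (Pi.single (Fin.rev i) 1)
  rw [hx] at h
  simp only [revForm, Pi.zero_apply, zero_mul, Finset.sum_const_zero, Pi.single_apply,
    Fin.rev_inj] at h
  simpa using h.symm

/-! ### Transvections and transitivity on nonzero vectors. -/

/-- The symplectic transvection `x ↦ x + ⟨a, x⟩ a`. -/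
def transvection {n : ℕ} (a : PauliVec n) : Matrix (Fin (2 * n)) (Fin (2 * n)) (ZMod 2) :=
  1 + Matrix.vecMulVec a fun j => a (Fin.rev j)

theorem transvection_mulVec {n : ℕ} (a x : PauliVec n) :
    (transvection a).mulVec x = x + revForm a x • a := by
  rw [transvection, Matrix.add_mulVec, Matrix.one_mulVec, revForm_comm]
  congr 1
  funext i
  simp only [Matrix.mulVec, dotProduct, Matrix.vecMulVec_apply, revForm, Pi.smul_apply, smul_eq_mul,
    Finset.sum_mul]
  exact Finset.sum_congr rfl fun j _ => by ring

theorem transvection_mem_symplecticMatrices {n : ℕ} (a : PauliVec n) :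
    transvection a ∈ symplecticMatrices n := by
  rw [mem_symplecticMatrices_iff]
  intro x y
  simp only [transvection_mulVec, revForm_add_left, revForm_add_right, revForm_smul_left,
    revForm_smul_right, revForm_self, mul_zero, add_zero]
  rw [revForm_comm x a, mul_comm (revForm a y), add_assoc, CharTwo.add_self_eq_zero, add_zero]

theorem transvection_mul_self {n : ℕ} (a : PauliVec n) : transvection a * transvection a = 1 := by
  refine Matrix.ext_of_mulVec_single fun i => ?_
  rw [← Matrix.mulVec_mulVec, Matrix.one_mulVec, transvection_mulVec, transvection_mulVec,
    revForm_add_right, revForm_smul_right, revForm_self, mul_zero, add_zero, add_assoc, ← add_smul,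
    CharTwo.add_self_eq_zero, zero_smul, add_zero]

/-- If `a` works only for `u` and `b` only for `w`, then `a + b` works for both. -/
theorem exists_revForm_eq_one {n : ℕ} {u w : PauliVec n} (hu : u ≠ 0) (hw : w ≠ 0) :
    ∃ z, revForm u z = 1 ∧ revForm w z = 1 := by
  have h01 : ∀ y : ZMod 2, y = 0 ∨ y = 1 := by decide
  have key : ∀ u : PauliVec n, u ≠ 0 → ∃ z, revForm u z = 1 := by
    intro u hu
    obtain ⟨i, hi⟩ := Function.ne_iff.1 hu
    refine ⟨Pi.single (Fin.rev i) 1, ?_⟩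
    have : revForm u (Pi.single (Fin.rev i) 1) = u i := by
      simp [revForm, Pi.single_apply, Fin.rev_inj]
    rw [this]
    exact (h01 (u i)).resolve_left hi
  obtain ⟨a, ha⟩ := key u hu
  obtain ⟨b, hb⟩ := key w hw
  rcases h01 (revForm w a) with h1 | h1
  · rcases h01 (revForm u b) with h2 | h2
    · exact ⟨a + b, by rw [revForm_add_right, ha, h2, add_zero],
        by rw [revForm_add_right, h1, hb, zero_add]⟩
    · exact ⟨b, h2, hb⟩
  · exact ⟨a, ha, h1⟩

/-- The symplectic group acts transitively on the nonzero vectors. -/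
theorem exists_symplectic_mulVec_eq {n : ℕ} {u w : PauliVec n} (hu : u ≠ 0) (hw : w ≠ 0) :
    ∃ B ∈ symplecticMatrices n, (∃ B', B' * B = 1) ∧ B.mulVec u = w := by
  have step : ∀ u w : PauliVec n, revForm u w = 1 → (transvection (u + w)).mulVec u = w := by
    intro u w h
    rw [transvection_mulVec, revForm_add_left, revForm_self, zero_add, revForm_comm, h, one_smul,
      ← add_assoc]
    funext i
    simp [CharTwo.add_self_eq_zero]
  -- A single transvection suffices only when the two vectors pair to `1`, so the route goes through
  -- a common partner `z`.
  obtain ⟨z, h1, h2⟩ := exists_revForm_eq_one hu hw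
  refine ⟨transvection (z + w) * transvection (u + z),
    mul_mem_symplecticMatrices (transvection_mem_symplecticMatrices _)
      (transvection_mem_symplecticMatrices _),
    ⟨transvection (u + z) * transvection (z + w), ?_⟩, ?_⟩
  · rw [mul_assoc, ← mul_assoc (transvection (z + w)), transvection_mul_self, one_mul,
      transvection_mul_self]
  · rw [← Matrix.mulVec_mulVec, step u z h1, step z w (by rw [revForm_comm, h2])]

/-! ### Counting symplectic matrices by the image of a vector. -/

open Classical in
/-- The finite set of all symplectic matrices. -/
noncomputable def symplecticFinset (n : ℕ) : Finset (Matrix (Fin (2 * n)) (Fin (2 * n)) (ZMod 2)) :=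
  Finset.univ.filter (· ∈ symplecticMatrices n)

theorem mem_symplecticFinset {n : ℕ} {C : Matrix (Fin (2 * n)) (Fin (2 * n)) (ZMod 2)} :
    C ∈ symplecticFinset n ↔ C ∈ symplecticMatrices n := by
  simp [symplecticFinset]

theorem card_symplecticFinset_pos (n : ℕ) : 0 < (symplecticFinset n).card :=
  Finset.card_pos.2 ⟨1, mem_symplecticFinset.2 (one_mem_symplecticMatrices n)⟩

/-- For fixed nonzero `x`, the number of symplectic matrices that map `x` to a given nonzero vector
is constant. -/
theorem card_mulVec_eq_le {n : ℕ} (x : PauliVec n) {u w : PauliVec n} (hu : u ≠ 0) (hw : w ≠ 0) :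
    ((symplecticFinset n).filter fun C => C.mulVec x = u).card ≤
      ((symplecticFinset n).filter fun C => C.mulVec x = w).card := by
  obtain ⟨B, hB, ⟨B', hB'⟩, hBu⟩ := exists_symplectic_mulVec_eq hu hw
  refine Finset.card_le_card_of_injOn (fun C => B * C) (fun C hC => ?_) fun C _ D _ h => ?_
  · simp only [Finset.coe_filter, Set.mem_ofPred_eq, mem_symplecticFinset] at hC ⊢
    refine ⟨mul_mem_symplecticMatrices hB hC.1, ?_⟩
    rw [← Matrix.mulVec_mulVec, hC.2, hBu]
  · have := congrArg (B' * ·) h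
    simpa [← mul_assoc, hB'] using this

/-- The number of vectors of which the first `m` coordinates vanish. -/
theorem card_initial_eq_zero {n m : ℕ} (hm : m ≤ 2 * n) :
    (Finset.univ.filter fun w : PauliVec n => ∀ i : Fin m, w (Fin.castLE hm i) = 0).card * 2 ^ m =
      2 ^ (2 * n) := by
  obtain ⟨l, hl⟩ := Nat.exists_eq_add_of_le hm
  let e : (Fin m → ZMod 2) × (Fin l → ZMod 2) ≃ PauliVec n :=
    (Fin.appendEquiv m l).trans (Equiv.piCongrLeft (fun _ => ZMod 2) (finCongr hl.symm))
  have he : ∀ y i, e y (Fin.castLE hm i) = y.1 i := by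
    intro y i
    have : Fin.castLE hm i = finCongr hl.symm (Fin.castAdd l i) := rfl
    rw [this]
    simp only [e, Equiv.trans_apply]
    rw [Equiv.piCongrLeft_apply_apply (fun _ => ZMod 2)]
    simp [Fin.appendEquiv]
  have h : (Finset.univ.filter fun w : PauliVec n => ∀ i : Fin m, w (Fin.castLE hm i) = 0).card =
      2 ^ l := by
    have h1 : (Finset.univ.filter fun w : PauliVec n => ∀ i : Fin m, w (Fin.castLE hm i) = 0) =
        (Finset.univ : Finset (Fin l → ZMod 2)).map
          ⟨fun y => e (0, y), fun y z h => (Prod.ext_iff.1 (e.injective h)).2⟩ := by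
      ext w
      simp only [Finset.mem_filter, Finset.mem_univ, true_and, Finset.mem_map]
      obtain ⟨⟨a, b⟩, rfl⟩ := e.surjective w
      simp only [he]
      constructor
      · intro h
        exact ⟨b, by rw [show a = 0 from funext h]; rfl⟩
      · rintro ⟨y, hy⟩
        have := (Prod.ext_iff.1 (e.injective hy)).1
        simp only at this
        simp [← this]
    rw [h1, Finset.card_map]
    simp [ZMod.card]
  rw [h, hl, add_comm m l, pow_add]

/-- At most a fraction `2^{-m}` of the symplectic matrices map a given nonzero vector to a vector of
which the first `m` coordinates vanish. -/
theorem card_syndrome_eq_zero_le {n : ℕ} (k : ℕ) {x : PauliVec n} (hx : x ≠ 0) :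
    ((symplecticFinset n).filter fun C => syndrome k C x = 0).card * 2 ^ (n - k) ≤
      (symplecticFinset n).card := by
  set m := n - k with hm
  have hmn : m ≤ 2 * n := by omega
  set N := ((symplecticFinset n).filter fun C => C.mulVec x = x).card with hN
  have hconst : ∀ w : PauliVec n, w ≠ 0 →
      ((symplecticFinset n).filter fun C => C.mulVec x = w).card = N := fun w hw =>
    (card_mulVec_eq_le x hw hx).antisymm (card_mulVec_eq_le x hx hw)
  have hzero : ((symplecticFinset n).filter fun C => C.mulVec x = 0).card = 0 := by
    rw [Finset.card_eq_zero, Finset.filter_eq_empty_iff]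
    exact fun C hC h => hx (eq_zero_of_mulVec_eq_zero (mem_symplecticFinset.1 hC) h)
  -- Each nonzero vector of `A` is hit by `N` matrices and `0` by none, so the count is `(A.card -
  -- 1) * N`, written without subtraction.
  have hfib : ∀ A : Finset (PauliVec n), 0 ∈ A →
      ((symplecticFinset n).filter fun C => C.mulVec x ∈ A).card + N = A.card * N := by
    intro A hA
    have hs := Finset.card_eq_sum_card_fiberwise (t := A) (f := fun C => Matrix.mulVec C x)
      (s := (symplecticFinset n).filter fun C => C.mulVec x ∈ A)
      fun C hC => (Finset.mem_filter.1 hC).2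
    rw [hs, ← Finset.add_sum_erase A _ hA,
      ← Finset.card_erase_add_one hA, add_mul, one_mul]
    congr 1
    have hf : ∀ w ∈ A, ((symplecticFinset n).filter fun C => C.mulVec x ∈ A).filter
        (fun C => C.mulVec x = w) = (symplecticFinset n).filter fun C => C.mulVec x = w := by
      intro w hw
      rw [Finset.filter_filter]
      refine Finset.filter_congr fun C _ => ⟨And.right, fun h => ⟨h ▸ hw, h⟩⟩
    rw [hf 0 hA, hzero, zero_add]
    rw [Finset.sum_congr rfl fun w hw => (congrArg Finset.card (hf w (Finset.mem_of_mem_erase hw))).trans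
      (hconst w (Finset.ne_of_mem_erase hw)), Finset.sum_const, smul_eq_mul]
  set A := Finset.univ.filter fun w : PauliVec n => ∀ i : Fin m, w (Fin.castLE hmn i) = 0 with hA
  have h1 := hfib A (by simp [hA])
  have h2 := hfib Finset.univ (Finset.mem_univ 0)
  have h3 : A.card * 2 ^ m = 2 ^ (2 * n) := card_initial_eq_zero hmn
  have h4 : ((symplecticFinset n).filter fun C => syndrome k C x = 0) =
      (symplecticFinset n).filter fun C => C.mulVec x ∈ A := by
    refine Finset.filter_congr fun C _ => ?_
    simp only [hA, Finset.mem_filter, Finset.mem_univ, true_and, funext_iff]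
    rfl
  have h5 : Fintype.card (PauliVec n) = 2 ^ (2 * n) := by simp [PauliVec, ZMod.card]
  rw [Finset.card_univ, h5, ← h3] at h2
  simp only [Finset.mem_univ, Finset.filter_true] at h2
  rw [h4]
  -- The claim is now `(A.card - 1) * N * 2 ^ m ≤ (A.card * 2 ^ m - 1) * N`.
  have h6 : 1 ≤ 2 ^ m := Nat.one_le_two_pow
  nlinarith

/-! ### The general converse and achievability bounds -/

theorem sum_le_sum_initial_of_antitone {N M : ℕ} (hM : M ≤ N) {f : Fin N → ℝ} (hf : Antitone f)
    (hf0 : ∀ j, 0 ≤ f j) {S : Finset (Fin N)} (hS : S.card ≤ M) :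
    ∑ j ∈ S, f j ≤ ∑ j : Fin N, if (j : ℕ) < M then f j else 0 := by
  -- Threshold argument: `f - t` is nonnegative on the first `M` indices and nonpositive afterwards,
  -- so its sum is largest on them. When `M = N` there is no index `M`, and `t = 0` serves.
  set t : ℝ := if h : M < N then f ⟨M, h⟩ else 0 with ht
  have ht0 : 0 ≤ t := by
    rw [ht]; split_ifs
    · exact hf0 _
    · exact le_rfl
  have h1 : ∀ j : Fin N, (j : ℕ) < M → t ≤ f j := by
    intro j hj
    rw [ht]; split_ifs
    · exact hf (Fin.le_def.2 hj.le)
    · exact hf0 _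
  have h2 : ∀ j : Fin N, ¬ (j : ℕ) < M → f j ≤ t := by
    intro j hj
    have h : M < N := lt_of_le_of_lt (not_lt.1 hj) j.isLt
    rw [ht, dif_pos h]
    exact hf (Fin.le_def.2 (not_lt.1 hj))
  have h3 : ∑ j, (if j ∈ S then f j - t else 0) ≤ ∑ j : Fin N, if (j : ℕ) < M then f j - t else 0 := by
    refine Finset.sum_le_sum fun j _ => ?_
    by_cases hj : (j : ℕ) < M
    · have := h1 j hj
      rw [if_pos hj]
      split_ifs <;> linarith
    · have := h2 j hj
      rw [if_neg hj]
      split_ifs <;> linarith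
  have h4 : (Finset.univ.filter fun j : Fin N => (j : ℕ) < M).card = M := by
    rw [Fin.card_filter_val_lt, min_eq_right hM]
  rw [← Finset.sum_filter, ← Finset.sum_filter, Finset.sum_sub_distrib, Finset.sum_sub_distrib,
    Finset.sum_const, Finset.sum_const, h4, Finset.filter_mem_eq_inter, Finset.univ_inter,
    nsmul_eq_mul, nsmul_eq_mul] at h3
  rw [← Finset.sum_filter]
  have h5 : (S.card : ℝ) * t ≤ M * t := by gcongr
  linarith

namespace PauliNoise

variable {n : ℕ} {V : Type*} [Fintype V]

theorem expect_mono (p : PauliNoise n V) {f g : PauliVec n → V → ℝ} (h : ∀ u v, f u v ≤ g u v) :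
    p.expect f ≤ p.expect g :=
  Finset.sum_le_sum fun u _ => Finset.sum_le_sum fun v _ =>
    mul_le_mul_of_nonneg_left (h u v) (p.mass_nonneg u v)

theorem probOf_not (p : PauliNoise n V) (E : PauliVec n → V → Prop) :
    p.probOf (fun u v => ¬ E u v) = 1 - p.probOf E := by
  classical
  rw [eq_sub_iff_add_eq, ← p.sum_mass, probOf, probOf, ← Finset.sum_add_distrib]
  refine Finset.sum_congr rfl fun u _ => ?_
  rw [← Finset.sum_add_distrib]
  refine Finset.sum_congr rfl fun v _ => ?_
  by_cases h : E u v <;> simp [h]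

/-- For fixed `v` the syndrome is injective on the correctly guessed errors, so there are at most `2
^ (n - k)` of them, with mass at most that of the head of the list. -/
theorem converseBound_le_wrongGuessProb (p : PauliNoise n V)
    {ord : V → Fin (2 ^ (2 * n)) ≃ PauliVec n} (hord : p.IsSorting ord) (k : ℕ)
    (C : Matrix (Fin (2 * n)) (Fin (2 * n)) (ZMod 2))
    (D : V → (Fin (n - k) → ZMod 2) → PauliVec n) :
    p.converseBound ord k ≤ p.wrongGuessProb k C D := by
  classical
  have e : p.converseBound ord k = 1 - p.probOf fun u v => position ord u v ≤ 2 ^ (n - k) := by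
    rw [← probOf_not, converseBound]
    simp only [not_le]
  rw [e, wrongGuessProb, probOf_not p fun u v => D v (syndrome k C u) = u]
  refine sub_le_sub_left ?_ 1
  unfold probOf
  refine (Finset.sum_comm.trans_le (Finset.sum_le_sum fun v _ => ?_)).trans_eq Finset.sum_comm
  set S := (Finset.univ.filter fun u => D v (syndrome k C u) = u) with hS
  have hcard : (S.map (ord v).symm.toEmbedding).card ≤ 2 ^ (n - k) := by
    rw [Finset.card_map]
    have h1 : S.card ≤ (Finset.univ : Finset (Fin (n - k) → ZMod 2)).card :=
      Finset.card_le_card_of_injOn (syndrome k C) (fun _ _ => Finset.mem_coe.2 (Finset.mem_univ _)) (by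
        intro u hu w hw h
        have hu' := (Finset.mem_filter.1 (Finset.mem_coe.1 hu)).2
        have hw' := (Finset.mem_filter.1 (Finset.mem_coe.1 hw)).2
        rw [← hu', ← hw', h])
    simpa [ZMod.card] using h1
  have h := sum_le_sum_initial_of_antitone
    (Nat.pow_le_pow_right (by norm_num) (by omega : n - k ≤ 2 * n))
    (hord v) (fun j => p.mass_nonneg _ v) hcard
  rw [Finset.sum_map] at h
  simp only [Equiv.coe_toEmbedding, Equiv.apply_symm_apply] at h
  refine le_trans (le_of_eq ?_) (h.trans (le_of_eq ?_))
  · simp only [hS, Finset.sum_filter]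
    exact Finset.sum_congr rfl fun u _ => by congr
  · rw [← Equiv.sum_comp (ord v)]
    refine Finset.sum_congr rfl fun j _ => ?_
    have hpos : position ord (ord v j) v = j + 1 := by rw [position, Equiv.symm_apply_apply]
    by_cases hj : (j : ℕ) < 2 ^ (n - k)
    · rw [if_pos hj, if_pos (by omega)]
    · rw [if_neg hj, if_neg (by omega)]

/-- For every `C` there is a decoder which is wrong only if a more likely error has the same
syndrome. -/
theorem exists_decoder {W : Type*} (ord : W → Fin (2 ^ (2 * n)) ≃ PauliVec n) (k : ℕ)
    (C : Matrix (Fin (2 * n)) (Fin (2 * n)) (ZMod 2)) :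
    ∃ D : W → (Fin (n - k) → ZMod 2) → PauliVec n, ∀ u v, D v (syndrome k C u) ≠ u →
      ∃ j < (ord v).symm u, syndrome k C (ord v j - u) = 0 := by
  classical
  -- Decode to the earliest vector of the list with the observed syndrome; syndromes that never
  -- occur get `0`.
  have h : ∀ v s, ∃ w : PauliVec n, ∀ u, syndrome k C u = s →
      syndrome k C w = s ∧ (ord v).symm w ≤ (ord v).symm u := by
    intro v s
    rcases (Finset.univ.filter fun u => syndrome k C u = s).eq_empty_or_nonempty with h | h
    · exact ⟨0, fun u hu => absurd hu (Finset.filter_eq_empty_iff.1 h (Finset.mem_univ u))⟩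
    · obtain ⟨w, hw, hmin⟩ := Finset.exists_min_image _ (fun u => (ord v).symm u) h
      exact ⟨w, fun u hu => ⟨(Finset.mem_filter.1 hw).2,
        hmin u (Finset.mem_filter.2 ⟨Finset.mem_univ u, hu⟩)⟩⟩
  choose D hD using h
  refine ⟨D, fun u v hne => ?_⟩
  obtain ⟨h1, h2⟩ := hD v _ u rfl
  refine ⟨(ord v).symm (D v (syndrome k C u)), lt_of_le_of_ne h2 fun h => hne ?_, ?_⟩
  · exact (ord v).symm.injective h
  · rw [Equiv.apply_symm_apply]
    funext i
    have := congrFun h1 i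
    simp only [syndrome] at this ⊢
    rw [Matrix.mulVec_sub, Pi.sub_apply, this, sub_self, Pi.zero_apply]

/-- Random coding: for each `(u, v)` bound the fraction of matrices whose decoder fails, by a union
bound over the earlier vectors of the list or trivially by `1`. Then average over the noise and pick
a matrix no worse than the mean. -/
theorem exists_wrongGuessProb_le_achievabilityBound (p : PauliNoise n V)
    (ord : V → Fin (2 ^ (2 * n)) ≃ PauliVec n) (k : ℕ) :
    ∃ C ∈ symplecticMatrices n, ∃ D : V → (Fin (n - k) → ZMod 2) → PauliVec n,
      p.wrongGuessProb k C D ≤ p.achievabilityBound ord k := by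
  classical
  choose D hD using exists_decoder ord k
  set G := symplecticFinset n with hG
  have hGpos : (0 : ℝ) < G.card := by exact_mod_cast card_symplecticFinset_pos n
  have hcount : ∀ u v, ((G.filter fun C => D C v (syndrome k C u) ≠ u).card : ℝ) ≤
      G.card * guessErrorBound (n - k) ((ord v).symm u) := by
    intro u v
    rw [guessErrorBound]
    split_ifs with h
    · rw [mul_one]
      exact_mod_cast Finset.card_filter_le _ _
    · have hsub : (G.filter fun C => D C v (syndrome k C u) ≠ u) ⊆
          (Finset.Iio ((ord v).symm u)).biUnion
            fun j => G.filter fun C => syndrome k C (ord v j - u) = 0 := by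
        intro C hC
        obtain ⟨hC1, hC2⟩ := Finset.mem_filter.1 hC
        obtain ⟨j, hj, hj0⟩ := hD C u v hC2
        exact Finset.mem_biUnion.2 ⟨j, Finset.mem_Iio.2 hj, Finset.mem_filter.2 ⟨hC1, hj0⟩⟩
      have h1 := (Finset.card_le_card hsub).trans Finset.card_biUnion_le
      have h2 : ∀ j ∈ Finset.Iio ((ord v).symm u),
          ((G.filter fun C => syndrome k C (ord v j - u) = 0).card : ℝ) ≤
            G.card / 2 ^ (n - k) := by
        intro j hj
        rw [le_div_iff₀ (by positivity)]
        refine mod_cast card_syndrome_eq_zero_le k (sub_ne_zero.2 fun h => ?_)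
        rw [← h, Equiv.symm_apply_apply] at hj
        exact lt_irrefl _ (Finset.mem_Iio.1 hj)
      have h3 := Finset.sum_le_sum h2
      rw [Finset.sum_const, Fin.card_Iio, nsmul_eq_mul] at h3
      calc _ ≤ _ := by exact_mod_cast h1
        _ ≤ _ := h3
        _ = _ := by ring
  have hsum : ∑ C ∈ G, p.wrongGuessProb k C (D C) ≤
      ∑ C ∈ G, p.achievabilityBound ord k := by
    have e : ∑ C ∈ G, p.wrongGuessProb k C (D C) = p.expect fun u v =>
        ((G.filter fun C => D C v (syndrome k C u) ≠ u).card : ℝ) := by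
      simp only [wrongGuessProb, probOf_eq_expect, expect]
      rw [Finset.sum_comm]
      refine Finset.sum_congr rfl fun u _ => ?_
      rw [Finset.sum_comm]
      refine Finset.sum_congr rfl fun v _ => ?_
      rw [← Finset.mul_sum, Finset.sum_boole]
    rw [e, Finset.sum_const, nsmul_eq_mul, achievabilityBound_eq_expect]
    refine (p.expect_mono hcount).trans (le_of_eq ?_)
    simp only [expect, Finset.mul_sum]
    exact Finset.sum_congr rfl fun u _ => Finset.sum_congr rfl fun v _ => by ring
  obtain ⟨C, hC, h⟩ := Finset.exists_le_of_sum_le (Finset.card_pos.1 (card_symplecticFinset_pos n))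
    hsum
  exact ⟨C, mem_symplecticFinset.1 hC, D C, h⟩

end PauliNoise

/-! ### From the general bounds to guessable rates. -/

theorem mem_guessableRates_erasureNoise {n k : ℕ} (hk : k ≤ n) {δ ε : ℝ}
    (hδ : δ ∈ Set.Icc (0 : ℝ) 1) (h : binomialMean n δ (achievabilityTerm (n - k)) ≤ ε) :
    (k : ℝ) / n ∈ (erasureNoise n δ hδ).guessableRates ε := by
  obtain ⟨ord, hord⟩ := (erasureNoise n δ hδ).exists_isSorting
  obtain ⟨C, hC, D, hD⟩ :=
    (erasureNoise n δ hδ).exists_wrongGuessProb_le_achievabilityBound ord k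
  rw [erasureNoise_achievabilityBound hδ hord] at hD
  exact ⟨k, hk, rfl, C, hC, D, hD.trans h⟩

theorem exists_of_mem_guessableRates_erasureNoise {n : ℕ} {δ ε r : ℝ}
    (hδ : δ ∈ Set.Icc (0 : ℝ) 1) (h : r ∈ (erasureNoise n δ hδ).guessableRates ε) :
    ∃ k ≤ n, r = (k : ℝ) / n ∧ binomialMean n δ (converseTerm (n - k)) ≤ ε := by
  obtain ⟨ord, hord⟩ := (erasureNoise n δ hδ).exists_isSorting
  obtain ⟨k, hk, rfl, C, -, D, hD⟩ := h
  refine ⟨k, hk, rfl, ?_⟩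
  rw [← erasureNoise_converseBound hδ hord]
  exact ((erasureNoise n δ hδ).converseBound_le_wrongGuessProb hord k C D).trans hD

theorem PauliNoise.finite_guessableRates {n : ℕ} {V : Type*} [Fintype V] (p : PauliNoise n V)
    (ε : ℝ) : (p.guessableRates ε).Finite := by
  refine ((Set.finite_Iic n).image fun k : ℕ => (k : ℝ) / n).subset ?_
  rintro r ⟨k, hk, rfl, -⟩
  exact ⟨k, hk, rfl⟩

theorem PauliNoise.isGreatest_errorGuessRate {n : ℕ} {V : Type*} [Fintype V] (p : PauliNoise n V)
    {ε : ℝ} (h : (p.guessableRates ε).Nonempty) :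
    IsGreatest (p.guessableRates ε) (p.errorGuessRate ε) :=
  ⟨h.csSup_mem (p.finite_guessableRates ε), fun _ hr =>
    le_csSup (p.finite_guessableRates ε).bddAbove hr⟩

/-! ### The optimal rate at small and at critical parameters -/

theorem binomialMean_zero (n : ℕ) (g : ℕ → ℝ) : binomialMean n 0 g = g 0 := by
  rw [binomialMean, Finset.sum_eq_single 0]
  · simp
  · intro j _ hj
    simp [zero_pow hj]
  · simp

theorem binomialMean_reflect (n : ℕ) (p : ℝ) (g : ℕ → ℝ) :
    binomialMean n p g = binomialMean n (1 - p) fun j => g (n - j) := by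
  rw [binomialMean, ← Finset.sum_range_reflect, binomialMean]
  refine Finset.sum_congr rfl fun j hj => ?_
  have hj' : j ≤ n := Nat.lt_succ_iff.mp (Finset.mem_range.mp hj)
  rw [show n + 1 - 1 - j = n - j by omega, Nat.choose_symm hj', Nat.sub_sub_self hj',
    sub_sub_cancel]
  ring

/-- For `n < 2 * e` the identity `4 ^ (n - e) = 4 ^ n / 4 ^ e` cancels the main terms, and the
remainder is negative; for `n = 2 * e` each term is at most `1 / 2`. -/
theorem achievabilityTerm_add_reflect_le {n e : ℕ} (he : e ≤ n) :
    achievabilityTerm n e + achievabilityTerm n (n - e) ≤ 1 := by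
  have key : ∀ e ≤ n, n < 2 * e → achievabilityTerm n e + achievabilityTerm n (n - e) ≤ 1 := by
    intro e he h
    have h4 : (4 : ℝ) ^ (n - e) * 4 ^ e = 2 ^ n * 2 ^ n := by
      rw [← pow_add, Nat.sub_add_cancel he, ← mul_pow]; norm_num
    have h5 : (4 : ℝ) ^ (n - e) = 2 ^ n * 2 ^ n * (1 / 4 ^ e) := by
      rw [← h4]; field_simp
    rw [achievabilityTerm, if_pos h, achievabilityTerm, if_neg (by omega), h5, pow_succ]
    have h6 : (2 ^ n * 2 ^ n * (1 / 4 ^ e) - 1) / (2 ^ n * 2 : ℝ) =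
        2 ^ n * (1 / 4 ^ e) / 2 - 1 / (2 ^ n * 2) := by
      field_simp
    rw [h6]
    have h7 : (0 : ℝ) ≤ 1 / 4 ^ e := by positivity
    have h8 : (0 : ℝ) ≤ 1 / (2 ^ n * 2) := by positivity
    linarith
  rcases lt_trichotomy n (2 * e) with h | h | h
  · exact key e he h
  · have hh : achievabilityTerm n e ≤ 1 / 2 := by
      rw [achievabilityTerm, if_neg (by omega), h, pow_succ, pow_mul]
      rw [div_le_div_iff₀ (by positivity) two_pos]
      norm_num
    rw [show n - e = e by omega]
    linarith
  · have := key (n - e) (by omega) (by omega)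
    rw [Nat.sub_sub_self he] at this
    linarith

/-- The symmetry of the binomial distribution at `1 / 2` lets `e` be averaged with `n - e`. This
makes rate `0` guessable in the critical case. -/
theorem binomialMean_half_achievabilityTerm_le (n : ℕ) :
    binomialMean n (1 / 2) (achievabilityTerm n) ≤ 1 / 2 := by
  have h1 := binomialMean_reflect n (1 / 2) (achievabilityTerm n)
  rw [show (1 : ℝ) - 1 / 2 = 1 / 2 by norm_num] at h1
  have h2 := binomialMean_mono (n := n) (p := 1 / 2) (by norm_num)
    (g := fun e => achievabilityTerm n e + achievabilityTerm n (n - e)) (h := fun _ => 1)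
    fun e he => achievabilityTerm_add_reflect_le he
  rw [binomialMean_add, binomialMean_one, ← h1] at h2
  linarith

/-! ### Normal approximation of the bounds -/

theorem sum_quarter_pow_le (L : ℕ) : ∑ i ∈ Finset.range L, (1 / 4 : ℝ) ^ i ≤ 2 := by
  rw [geom_sum_eq (by norm_num)]
  have : (0 : ℝ) ≤ (1 / 4) ^ L := by positivity
  rw [div_le_iff_of_neg (by norm_num)]
  linarith

/-- With truncated subtraction the exponent is `|M - j|`; each side of `M` is a geometric sum. -/
theorem sum_quarter_pow_dist_le (M K : ℕ) :
    ∑ j ∈ Finset.range K, (1 / 4 : ℝ) ^ ((M - j) + (j - M)) ≤ 4 := by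
  have h1 : ∑ j ∈ Finset.range K, (1 / 4 : ℝ) ^ ((M - j) + (j - M)) ≤
      ∑ j ∈ Finset.range (M + K), (1 / 4 : ℝ) ^ ((M - j) + (j - M)) :=
    Finset.sum_le_sum_of_subset_of_nonneg (Finset.range_subset_range.2 (by omega))
      fun _ _ _ => by positivity
  rw [Finset.sum_range_add] at h1
  have h2 : ∑ j ∈ Finset.range M, (1 / 4 : ℝ) ^ ((M - j) + (j - M)) ≤ 2 := by
    rw [← Finset.sum_range_reflect]
    refine (Finset.sum_le_sum fun j hj => ?_).trans (sum_quarter_pow_le M)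
    have := Finset.mem_range.1 hj
    exact pow_le_pow_of_le_one (by norm_num) (by norm_num) (by omega)
  have h3 : ∑ j ∈ Finset.range K, (1 / 4 : ℝ) ^ ((M - (M + j)) + (M + j - M)) ≤ 2 := by
    refine (Finset.sum_le_sum fun j _ => ?_).trans (sum_quarter_pow_le K)
    exact pow_le_pow_of_le_one (by norm_num) (by norm_num) (by omega)
  linarith

theorem binomial_weight_le {n j : ℕ} (hj : j ≤ n) {p : ℝ} (hp : p ∈ Set.Ioo (0 : ℝ) 1)
    (hs : 0 < √(n * p * (1 - p))) :
    (n.choose j : ℝ) * p ^ j * (1 - p) ^ (n - j) ≤ 1 / √(n * p * (1 - p)) := by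
  have h := binomialMean_point_le (n := n) hp j
  have hp0 := hp.1
  have hq : 0 < 1 - p := by linarith [hp.2]
  rw [binomialMean, Finset.sum_eq_single_of_mem j (Finset.mem_range.2 (by omega)) fun i _ hi => by
    rw [if_neg hi, mul_zero], if_pos rfl, mul_one] at h
  exact h.trans (one_div_le_one_div_of_le hs (Real.sqrt_le_sqrt (by gcongr; linarith)))

theorem binomialMean_quarter_pow_dist_le (n M : ℕ) {p : ℝ} (hp : p ∈ Set.Ioo (0 : ℝ) 1)
    (hs : 0 < √(n * p * (1 - p))) :
    binomialMean n p (fun e => (1 / 4) ^ ((M - e) + (e - M))) ≤ 4 / √(n * p * (1 - p)) := by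
  rw [binomialMean]
  refine (Finset.sum_le_sum fun j hj => mul_le_mul_of_nonneg_right
    (binomial_weight_le (Nat.lt_succ_iff.mp (Finset.mem_range.mp hj)) hp hs) (by positivity)).trans
    ?_
  rw [← Finset.mul_sum]
  calc _ ≤ 1 / √(n * p * (1 - p)) * 4 := by
        gcongr
        exact sum_quarter_pow_dist_le M (n + 1)
    _ = _ := by ring

theorem achievabilityTerm_le (m e : ℕ) :
    achievabilityTerm m e ≤
      1 - (if e ≤ m / 2 then 1 else 0) + (1 / 4) ^ ((m / 2 - e) + (e - m / 2)) := by
  rw [achievabilityTerm]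
  by_cases h : m < 2 * e
  · rw [if_pos h, if_neg (by omega)]
    have h1 : (0 : ℝ) ≤ (2 ^ m + 1) / 2 * (1 / 4 ^ e) := by positivity
    have h2 : (0 : ℝ) ≤ (1 / 4) ^ ((m / 2 - e) + (e - m / 2)) := by positivity
    linarith
  · rw [if_neg h, if_pos (by omega), show m / 2 - e + (e - m / 2) = m / 2 - e by omega, one_div_pow,
      sub_self, zero_add, div_le_div_iff₀ (by positivity) (by positivity)]
    have h1 : (4 : ℝ) ^ e * 4 ^ (m / 2 - e) ≤ 2 ^ (m + 1) := by
      rw [← pow_add, show (4 : ℝ) = 2 ^ 2 by norm_num, ← pow_mul]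
      exact pow_le_pow_right₀ (by norm_num) (by omega)
    have h2 : (0 : ℝ) ≤ 4 ^ (m / 2 - e) := by positivity
    linarith

/-- The factor `2` comes from odd `m`, where `2 ^ m = 2 * 4 ^ (m / 2)`. -/
theorem le_converseTerm (m e : ℕ) :
    1 - (if e ≤ m / 2 then 1 else 0) - 2 * (1 / 4) ^ ((m / 2 - e) + (e - m / 2)) ≤
      converseTerm m e := by
  rw [converseTerm]
  by_cases h : m < 2 * e
  · rw [if_pos h, if_neg (by omega), show m / 2 - e + (e - m / 2) = e - m / 2 by omega, one_div_pow,
      sub_zero]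
    have h1 : (2 : ℝ) ^ m * 4 ^ (e - m / 2) ≤ 2 * 4 ^ e := by
      rw [show (4 : ℝ) = 2 ^ 2 by norm_num, ← pow_mul, ← pow_mul, ← pow_add, ← pow_succ']
      exact pow_le_pow_right₀ (by norm_num) (by omega)
    have h2 : (2 : ℝ) ^ m * (1 / 4 ^ e) ≤ 2 * (1 / 4 ^ (e - m / 2)) := by
      rw [mul_one_div, mul_one_div, div_le_div_iff₀ (by positivity) (by positivity)]
      exact h1
    linarith
  · rw [if_neg h, if_pos (by omega)]
    have h2 : (0 : ℝ) ≤ (1 / 4) ^ ((m / 2 - e) + (e - m / 2)) := by positivity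
    linarith

theorem abs_binomialMean_le_sub_normalCDF_le (n M : ℕ) {p : ℝ} (hp : p ∈ Set.Ioo (0 : ℝ) 1) {s : ℝ}
    (hs : s = √(n * p * (1 - p))) (hs1 : 1 ≤ s) :
    |binomialMean n p (fun e => if e ≤ M then 1 else 0) - normalCDF ((M - n * p) / s)| ≤
      (4 * √(2 * Real.pi) + 12) / s := by
  cases n with
  | zero =>
    exfalso
    rw [hs] at hs1
    norm_num at hs1
  | succ n =>
    have h := abs_binomialMean_sub_normalCDF_le hp (n := n) (s := s) (by rw [hs]; push_cast; rfl) hs1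
      ((M - ((n + 1 : ℕ) : ℝ) * p) / s)
    have e : (fun j : ℕ => if ((j : ℝ) - (n + 1) * p) / s ≤ (M - ((n + 1 : ℕ) : ℝ) * p) / s
        then (1 : ℝ) else 0) = fun j => if j ≤ M then 1 else 0 := by
      funext j
      congr 1
      rw [div_le_div_iff_of_pos_right (by linarith), eq_iff_iff]
      push_cast
      rw [sub_le_sub_iff_right, Nat.cast_le]
    rwa [e] at h

/-- A constant for the normal approximation of the bounds. -/
noncomputable def normalApproxConst : ℝ := 4 * √(2 * Real.pi) + 20

theorem binomialMean_achievabilityTerm_le (n m : ℕ) {p : ℝ} (hp : p ∈ Set.Ioo (0 : ℝ) 1) {s : ℝ}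
    (hs : s = √(n * p * (1 - p))) (hs1 : 1 ≤ s) :
    binomialMean n p (achievabilityTerm m) ≤
      1 - normalCDF (((m / 2 : ℕ) - n * p) / s) + normalApproxConst / s := by
  have h1 := abs_le.1 (abs_binomialMean_le_sub_normalCDF_le n (m / 2) hp hs hs1)
  have h2 := binomialMean_quarter_pow_dist_le n (m / 2) hp (by rw [← hs]; linarith)
  have h3 := binomialMean_mono (n := n) ⟨hp.1.le, hp.2.le⟩ fun e _ => achievabilityTerm_le m e
  rw [binomialMean_add, binomialMean_sub, binomialMean_one] at h3
  rw [← hs] at h2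
  have h4 : normalApproxConst / s = (4 * √(2 * Real.pi) + 12) / s + 4 / s + 4 / s := by
    rw [normalApproxConst]; ring
  have h5 : 0 ≤ 4 / s := by positivity
  linarith

theorem le_binomialMean_converseTerm (n m : ℕ) {p : ℝ} (hp : p ∈ Set.Ioo (0 : ℝ) 1) {s : ℝ}
    (hs : s = √(n * p * (1 - p))) (hs1 : 1 ≤ s) :
    1 - normalCDF (((m / 2 : ℕ) - n * p) / s) - normalApproxConst / s ≤
      binomialMean n p (converseTerm m) := by
  have h1 := abs_le.1 (abs_binomialMean_le_sub_normalCDF_le n (m / 2) hp hs hs1)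
  have h2 := binomialMean_quarter_pow_dist_le n (m / 2) hp (by rw [← hs]; linarith)
  have h3 := binomialMean_mono (n := n) ⟨hp.1.le, hp.2.le⟩ fun e _ => le_converseTerm m e
  rw [binomialMean_sub, binomialMean_sub, binomialMean_one, binomialMean_const_mul] at h3
  rw [← hs] at h2
  -- The `20` is `12` from Berry–Esseen plus `2 * 4` from the geometric correction, doubled in the
  -- converse.
  have h4 : normalApproxConst / s = (4 * √(2 * Real.pi) + 12) / s + 4 / s + 4 / s := by
    rw [normalApproxConst]; ring
  linarith

/-! ### The optimal rate -/

/-- Bounds on the guessable rates in terms of `s = √(n δ (1 - δ))`. -/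
theorem exists_guessableRates_bounds {δ ε : ℝ} (hδ : δ ∈ Set.Icc (0 : ℝ) 1) (hδ0 : 0 < δ)
    (hε : ε ∈ Set.Ioo (0 : ℝ) 1) (h : δ < 1 / 2 ∨ δ = 1 / 2 ∧ 1 / 2 ≤ ε) :
    ∃ K S : ℝ, ∀ (n : ℕ) (s : ℝ), s = √(n * δ * (1 - δ)) → S ≤ s →
      (∃ r ∈ (erasureNoise n δ hδ).guessableRates ε,
        (n * (1 - 2 * δ) + 2 * normalCDFInv ε * s - K) / n ≤ r) ∧
      ∀ r ∈ (erasureNoise n δ hδ).guessableRates ε,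
        r ≤ (n * (1 - 2 * δ) + 2 * normalCDFInv ε * s + K) / n := by
  set t := normalCDFInv ε with ht
  have hΦ : normalCDF (-t) = 1 - ε := by rw [normalCDF_neg, ht, normalCDF_normalCDFInv hε]
  obtain ⟨c, hc, hcdf⟩ := exists_normalCDF_add_ge (-t)
  set b := normalApproxConst / c with hb
  have hb0 : 0 ≤ b := by rw [hb, normalApproxConst]; positivity
  have hδ2 : δ ≤ 1 / 2 := h.elim le_of_lt fun h => h.1.le
  have hδ1 : δ ∈ Set.Ioo (0 : ℝ) 1 := ⟨hδ0, by linarith⟩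
  -- The lower bounds on `s` serve in turn for Berry–Esseen, for staying in the window where `Φ` has
  -- slope at least `c`, for `k ≤ n`, and for `0 ≤ τ` when `δ < 1 / 2` (at `δ = 1 / 2` the quotient
  -- is `0` and harmless). In `2 * b + 3`, the part `2 * b` absorbs the normal approximation and the
  -- rest covers roundings.
  refine ⟨2 * b + 3, max 1 (max b (max |t| ((2 * |t| + (2 * b + 2)) / (1 - 2 * δ)))),
    fun n s hs hS => ?_⟩
  simp only [max_le_iff] at hS
  obtain ⟨hs1, hsb, hst, hsL⟩ := hS
  have hs0 : 0 < s := by linarith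
  have hss : s ^ 2 = n * δ * (1 - δ) := by
    rw [hs, Real.sq_sqrt (mul_nonneg (mul_nonneg n.cast_nonneg hδ0.le) (by linarith))]
  have hssn : s ^ 2 ≤ n * δ := by
    rw [hss]
    exact mul_le_of_le_one_right (mul_nonneg n.cast_nonneg hδ0.le) (by linarith)
  have hn : (0 : ℝ) < n := by
    rcases n.eq_zero_or_pos with rfl | h
    · simp only [Nat.cast_zero, zero_mul] at hssn
      nlinarith
    · exact_mod_cast h
  have hbs : b / s ≤ 1 := by rwa [div_le_one hs0]
  have hbs0 : 0 ≤ b / s := by positivity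
  have hcb : c * (b / s) = normalApproxConst / s := by rw [hb]; field_simp
  constructor
  · set τ := n * (1 - 2 * δ) + 2 * t * s - (2 * b + 2) with hτ
    rcases le_or_gt 0 τ with h0 | h0
    · have hk := Nat.floor_le h0
      have hk' := Nat.lt_floor_add_one τ
      set k := ⌊τ⌋₊ with hkdef
      have hts : t * s ≤ n * δ := by nlinarith [le_abs_self t]
      have hkn : k ≤ n := by
        have : (k : ℝ) ≤ n := by linarith
        exact_mod_cast this
      refine ⟨(k : ℝ) / n, mem_guessableRates_erasureNoise hkn hδ ?_, ?_⟩
      · refine (binomialMean_achievabilityTerm_le n (n - k) hδ1 hs hs1).trans ?_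
        have hm : (n : ℝ) - k ≤ 2 * ((n - k) / 2 : ℕ) + 1 := by
          rw [← Nat.cast_sub hkn]
          exact_mod_cast (by omega : n - k ≤ 2 * ((n - k) / 2) + 1)
        have hx : -t + b / s ≤ (((n - k) / 2 : ℕ) - n * δ) / s := by
          rw [le_div_iff₀ hs0, add_mul, div_mul_cancel₀ _ hs0.ne']
          linarith
        have h1 := strictMono_normalCDF.monotone hx
        have h2 := hcdf (-t) (-t + b / s) (by linarith) (by linarith) (by linarith)
        rw [add_sub_cancel_left, hcb] at h2
        linarith
      · gcongr
        linarith
    -- A negative target cannot occur for `δ < 1 / 2`, since `n * (1 - 2 * δ)` dominates; at `δ = 1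
    -- / 2` rate `0` is above the target.
    · rcases h with h | ⟨rfl, h⟩
      · exfalso
        have h1 : 0 < 1 - 2 * δ := by linarith
        rw [div_le_iff₀ h1] at hsL
        have h2 : s ^ 2 * (1 - 2 * δ) ≤ n * (1 - 2 * δ) := by
          have : (n : ℝ) * δ ≤ n := mul_le_of_le_one_right hn.le hδ.2
          gcongr
          linarith
        have h3 : -|t| * s ≤ t * s := mul_le_mul_of_nonneg_right (neg_abs_le t) hs0.le
        nlinarith
      · have hmem := mem_guessableRates_erasureNoise (Nat.zero_le n) hδ
          ((binomialMean_half_achievabilityTerm_le n).trans h)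
        rw [Nat.cast_zero, zero_div] at hmem
        exact ⟨0, hmem, div_nonpos_of_nonpos_of_nonneg (by linarith) hn.le⟩
  · intro r hr
    obtain ⟨k, hkn, rfl, hk⟩ := exists_of_mem_guessableRates_erasureNoise hδ hr
    have h1 := (le_binomialMean_converseTerm n (n - k) hδ1 hs hs1).trans hk
    have hx : -t - b / s ≤ (((n - k) / 2 : ℕ) - n * δ) / s := by
      by_contra! hlt
      have h2 := strictMono_normalCDF hlt
      have h3 := hcdf (-t - b / s) (-t) (by linarith) (by linarith) (by linarith)
      rw [sub_sub_cancel, hcb] at h3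
      linarith
    rw [le_div_iff₀ hs0, sub_mul, div_mul_cancel₀ _ hs0.ne'] at hx
    have hm : 2 * (((n - k) / 2 : ℕ) : ℝ) ≤ n - k := by
      rw [← Nat.cast_sub hkn]
      exact_mod_cast (by omega : 2 * ((n - k) / 2) ≤ n - k)
    gcongr
    linarith

theorem eventually_guessableRates_bounds {δ ε : ℝ} (hδ : δ ∈ Set.Icc (0 : ℝ) 1)
    (hε : ε ∈ Set.Ioo (0 : ℝ) 1) (h : δ < 1 / 2 ∨ δ = 1 / 2 ∧ 1 / 2 ≤ ε) :
    ∃ K : ℝ, ∀ᶠ n : ℕ in atTop,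
      (∃ r ∈ (erasureNoise n δ hδ).guessableRates ε,
        1 - 2 * δ + 2 * normalCDFInv ε * √(δ * (1 - δ)) / √(n : ℝ) - K * (1 / n) ≤ r) ∧
      ∀ r ∈ (erasureNoise n δ hδ).guessableRates ε,
        r ≤ 1 - 2 * δ + 2 * normalCDFInv ε * √(δ * (1 - δ)) / √(n : ℝ) + K * (1 / n) := by
  -- Without erasures `s = 0` and the normal approximation is void, but the error is always zero and
  -- `k = n` works.
  rcases hδ.1.eq_or_lt with rfl | hδ0
  · refine ⟨0, (eventually_gt_atTop 0).mono fun n hn => ?_⟩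
    have hn' : (n : ℝ) ≠ 0 := by exact_mod_cast hn.ne'
    simp only [mul_zero, zero_mul, Real.sqrt_zero, zero_div, sub_zero, add_zero]
    constructor
    · refine ⟨(n : ℝ) / n, mem_guessableRates_erasureNoise le_rfl hδ ?_, (div_self hn').ge⟩
      rw [binomialMean_zero]
      simp [achievabilityTerm, hε.1.le]
    · rintro r ⟨k, hk, rfl, -⟩
      exact div_le_one_of_le₀ (by exact_mod_cast hk) n.cast_nonneg
  · obtain ⟨K, S, hKS⟩ := exists_guessableRates_bounds hδ hδ0 hε h
    have hδ2 : δ ≤ 1 / 2 := h.elim le_of_lt fun h => h.1.le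
    have hσ : 0 < δ * (1 - δ) := mul_pos hδ0 (by linarith)
    have hlim : Tendsto (fun n : ℕ => √((n : ℝ) * δ * (1 - δ))) atTop atTop := by
      refine Real.tendsto_sqrt_atTop.comp ?_
      simp only [mul_assoc]
      exact tendsto_natCast_atTop_atTop.atTop_mul_const hσ
    refine ⟨K, ((hlim.eventually_ge_atTop S).and (eventually_gt_atTop 0)).mono ?_⟩
    rintro n ⟨hS, hn⟩
    have hn' : (0 : ℝ) < n := by exact_mod_cast hn
    have hsq : √((n : ℝ) * δ * (1 - δ)) = n * (√(δ * (1 - δ)) / √(n : ℝ)) := by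
      rw [mul_assoc, Real.sqrt_mul hn'.le, mul_div_left_comm, Real.div_sqrt, mul_comm]
    have e : ∀ x : ℝ, (n * (1 - 2 * δ) + 2 * normalCDFInv ε * √((n : ℝ) * δ * (1 - δ)) + x) / n =
        1 - 2 * δ + 2 * normalCDFInv ε * √(δ * (1 - δ)) / √(n : ℝ) + x * (1 / n) := by
      intro x
      rw [hsq]
      field_simp
    have h1 := hKS n _ rfl hS
    rw [sub_eq_add_neg, e, e, neg_mul, ← sub_eq_add_neg] at h1
    exact h1

theorem mainTheorem5 (δ : ℝ) (hδ : δ ∈ Set.Icc (0 : ℝ) 1) :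
    (∀ (n k : ℕ), k ≤ n →
      ∀ ord : (Fin n → ZMod 2) → Fin (2 ^ (2 * n)) ≃ PauliVec n,
      (erasureNoise n δ hδ).IsSorting ord →
      ∀ m : ℕ, m = n - k →
      (erasureNoise n δ hδ).converseBound ord k =
          binomialCDF n (1 - δ) ((n : ℤ) - (m / 2 : ℕ) - 1)
          - 2 ^ m * ((4 - 3 * δ) / 4) ^ n *
            binomialCDF n ((4 - 4 * δ) / (4 - 3 * δ)) ((n : ℤ) - (m / 2 : ℕ) - 1) ∧
      (erasureNoise n δ hδ).achievabilityBound ord k =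
          (1 + 1 / 2 ^ (m + 1)) * binomialCDF n (1 - δ) ((n : ℤ) - (m / 2 : ℕ) - 1)
          - 1 / 2 ^ (m + 1)
          - (2 ^ m + 1) / 2 * ((4 - 3 * δ) / 4) ^ n *
            binomialCDF n ((4 - 4 * δ) / (4 - 3 * δ)) ((n : ℤ) - (m / 2 : ℕ) - 1)
          + (1 + 3 * δ) ^ n / 2 ^ (m + 1) *
            binomialCDF n (4 * δ / (1 + 3 * δ)) ((m / 2 : ℕ) : ℤ)) ∧
    (∀ ε : ℝ, ε ∈ Set.Ioo (0 : ℝ) 1 → (δ < 1 / 2 ∨ δ = 1 / 2 ∧ 1 / 2 ≤ ε) →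
      (∀ᶠ n : ℕ in atTop, IsGreatest ((erasureNoise n δ hδ).guessableRates ε)
        ((erasureNoise n δ hδ).errorGuessRate ε)) ∧
      (fun n : ℕ => (erasureNoise n δ hδ).errorGuessRate ε -
          (1 - 2 * δ + 2 * normalCDFInv ε * √(δ * (1 - δ)) / √(n : ℝ)))
        =O[atTop] fun n : ℕ => 1 / (n : ℝ)) := by
  refine ⟨fun n k _ ord hord m hm => ?_, fun ε hε h => ?_⟩
  · subst hm
    exact ⟨(erasureNoise_converseBound hδ hord k).trans (binomialMean_converseTerm n _ hδ),
      (erasureNoise_achievabilityBound hδ hord k).trans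
        (binomialMean_achievabilityTerm (Nat.sub_le n k) hδ)⟩
  · obtain ⟨K, hK⟩ := eventually_guessableRates_bounds hδ hε h
    have hmax : ∀ᶠ n : ℕ in atTop, IsGreatest ((erasureNoise n δ hδ).guessableRates ε)
        ((erasureNoise n δ hδ).errorGuessRate ε) :=
      hK.mono fun n hn => PauliNoise.isGreatest_errorGuessRate _ (hn.1.imp fun _ => And.left)
    refine ⟨hmax, IsBigO.of_bound K ?_⟩
    filter_upwards [hK, hmax] with n ⟨⟨r, hr, hr1⟩, h2⟩ hn
    have h3 := h2 _ hn.1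
    have h4 := hn.2 hr
    rw [Real.norm_eq_abs, Real.norm_of_nonneg (by positivity), abs_le]
    constructor <;> linarith
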